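/- Conventions. Let $C^*_d$ be the boundary complex of the $d$-dimensional cross polytope, on the vertex set $\{x_1,\dots,x_d,y_1,\dots,y_d\}$ with $x_j,y_j$ antipodal: its faces are the sets of vertices containing no pair $\{x_j,y_j\}$. Its facets correspond to words $u=u_1\cdots u_d$ in the letters $x,y$; a switch of $u$ is an index $1\le j\le d-1$ with $u_j\ne u_{j+1}$. Let $\mathcal B(i,d)$ be the subcomplex of $C^*_d$ generated by the facets whose words have at most $i$ switches, and $\partial\mathcal B(i,d)$ its boundary complex, generated by the $(d-2)$-dimensional faces lying in exactly one facet of $\mathcal B(i,d)$. A combinatorial $n$-manifold (without boundary) is a nonempty finite simplicial complex in which the link of every nonempty face $\sigma$ triangulates a sphere of dimension $n-|\sigma|$. A complex is centrally symmetric (cs) if it has an involution of its vertex set that induces a free involution on its nonempty faces; the pairs $\{v,\alpha(v)\}$ of this involution $\alpha$ are called antipodal. If a cs complex has $2k$ vertices, it is said to contain the $r$-skeleton of the $k$-dimensional cross polytope if every set of at most $r+1$ vertices without an antipodal pair is a face. Sparla conjectured that every cs combinatorial $2r$-manifold $M$ with $2k$ vertices satisfies $$(-1)^r\binom{2r+1}{r+1}(\chi(M)-2)\le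 4^{r+1}\binom{\frac12(k-1)}{r+1},\qquad(*)$$ and, as the second assertion, that equality is attained if and only if $M$ contains the $r$-skeleton of the $k$-dimensional cross polytope. Theorem. Let $r\ge 0$, $0\le i\le 2r$ and $M=\partial\mathcal B(i,2r+2)$. Then $M$ is a combinatorial $2r$-manifold, centrally symmetric with respect to $x_j\leftrightarrow y_j$, with exactly $4r+4$ vertices; it is a triangulation of $\mathbb S^i\times\mathbb S^{2r-i}$, and $\chi(M)-2=2(-1)^i$. If moreover $i<r$ and $i$ has the same parity as $r$, then equality holds in $(*)$ for $M$ with $k=2r+2$, but $M$ does not contain the $r$-skeleton of the $(2r+2)$-dimensional cross polytope $C^*_{2r+2}$. Hence, whenever such an $i$ exists (that is, $r\ge2$), the second assertion of Sparla's conjecture is false for $2k=4r+4$ vertices. -/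

import Mathlib

namespace SparlaCS

section General

variable {V : Type*}

/-- The vertex set of a (finite, abstract) simplicial complex. Faces are nonempty finite sets;
the empty face is left implicit throughout. -/
def vertices (K : PreAbstractSimplicialComplex V) : Set V := {v | {v} ∈ K.faces}

/-- The `r`-skeleton: all faces of dimension at most `r`, that is, with at most `r + 1` vertices. -/
def skeleton (r : ℕ) (K : PreAbstractSimplicialComplex V) : PreAbstractSimplicialComplex V where
  faces := {σ | σ ∈ K.faces ∧ σ.card ≤ r + 1}
  isRelLowerSet_faces := fun _ hs =>
    ⟨(K.isRelLowerSet_faces hs.1).1, fun _ hts ht =>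
      ⟨(K.isRelLowerSet_faces hs.1).2 hts ht, (Finset.card_le_card hts).trans hs.2⟩⟩

/-- The link of `σ` in `K`: all nonempty `τ` disjoint from `σ` such that `τ ∪ σ` is a face. -/
def link [DecidableEq V] (K : PreAbstractSimplicialComplex V) (σ : Finset V) :
    PreAbstractSimplicialComplex V where
  faces := {τ | τ.Nonempty ∧ Disjoint τ σ ∧ τ ∪ σ ∈ K.faces}
  isRelLowerSet_faces := fun _ hs =>
    ⟨hs.1, fun _ hts ht =>
      ⟨ht, Finset.disjoint_of_subset_left hts hs.2.1,
        (K.isRelLowerSet_faces hs.2.2).2 (Finset.union_subset_union_left hts)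
          (ht.mono Finset.subset_union_left)⟩⟩

/-- The boundary complex of a pure `n`-dimensional complex `K` (a combinatorial manifold with
boundary): the subcomplex generated by the `(n - 1)`-dimensional faces of `K` (those with `n`
vertices) that lie in exactly one `n`-dimensional face of `K`. -/
def boundary (n : ℕ) (K : PreAbstractSimplicialComplex V) : PreAbstractSimplicialComplex V where
  faces := {σ | σ.Nonempty ∧ ∃ τ ∈ K.faces, τ.card = n ∧ σ ⊆ τ ∧
    ∃! F : Finset V, F ∈ K.faces ∧ F.card = n + 1 ∧ τ ⊆ F}
  isRelLowerSet_faces := fun _ hs =>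
    ⟨hs.1, fun _ hts ht => by
      obtain ⟨_, τ, hτ, hc, hsub, hu⟩ := hs
      exact ⟨ht, τ, hτ, hc, hts.trans hsub, hu⟩⟩

/-- The geometric realization of a complex on a finite set `V`, in barycentric coordinates, with
the topology induced from `ℝ^V`. -/
def realization [Fintype V] (K : PreAbstractSimplicialComplex V) : Set (V → ℝ) :=
  {x | (∀ v, 0 ≤ x v) ∧ ∑ v, x v = 1 ∧ ∃ σ ∈ K.faces, ∀ v, v ∈ σ ↔ x v ≠ 0}

/-- The unit sphere of `ℝ^m`, of dimension `m - 1`; it is empty for `m = 0`. -/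
abbrev unitSphere (m : ℕ) : Set (EuclideanSpace ℝ (Fin m)) :=
  Metric.sphere (0 : EuclideanSpace ℝ (Fin m)) 1

/-- `K` is an `n`-dimensional combinatorial manifold (without boundary): it is nonempty, and the
link of every nonempty face `σ` triangulates a sphere of dimension `n - |σ|`. In particular all
facets have `n + 1` vertices, their links being the empty sphere of dimension `-1`. -/
def IsCombinatorialManifold [Fintype V] [DecidableEq V] (n : ℕ)
    (K : PreAbstractSimplicialComplex V) : Prop :=
  K.faces.Nonempty ∧ ∀ σ ∈ K.faces, ∃ m : ℕ, m + σ.card = n + 1 ∧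
    Nonempty (realization (link K σ) ≃ₜ unitSphere m)

/-- `K` is centrally symmetric with respect to `α`: `α` is an involution of the vertices that
induces a free involution on the set of nonempty faces. -/
def IsCentrallySymmetric [DecidableEq V] (α : V → V) (K : PreAbstractSimplicialComplex V) : Prop :=
  Function.Involutive α ∧ ∀ σ ∈ K.faces, σ.image α ∈ K.faces ∧ σ.image α ≠ σ

/-- The number of `j`-dimensional faces. -/
noncomputable def faceNumber (K : PreAbstractSimplicialComplex V) (j : ℕ) : ℕ :=
  {σ | σ ∈ K.faces ∧ σ.card = j + 1}.ncard

/-- The Euler characteristic `f₀ - f₁ + f₂ - ⋯`. -/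
noncomputable def eulerChar [Fintype V] (K : PreAbstractSimplicialComplex V) : ℤ :=
  ∑ j ∈ Finset.range (Fintype.card V), (-1) ^ j * (faceNumber K j : ℤ)

/-- For a fixed-point-free involution `α` of a set of `2k` points, the boundary complex of the
`k`-dimensional cross polytope with these points as vertices and `v`, `α v` antipodal: its
faces are the nonempty sets of vertices that contain no antipodal pair. -/
def crossPolytope (α : V → V) : PreAbstractSimplicialComplex V where
  faces := {σ | σ.Nonempty ∧ ∀ v ∈ σ, α v ∉ σ}
  isRelLowerSet_faces := fun _ hs =>
    ⟨hs.1, fun _ hts ht => ⟨ht, fun v hv h => hs.2 v (hts hv) (hts h)⟩⟩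

/-- Equality in Sparla's inequality
`(-1)^r * C(2r+1, r+1) * (χ(K) - 2) ≤ 4^(r+1) * C((k-1)/2, r+1)`
for a complex `K` with `2k` vertices; the last binomial coefficient has a rational upper entry. -/
def SparlaEquality [Fintype V] (r k : ℕ) (K : PreAbstractSimplicialComplex V) : Prop :=
  (-1 : ℚ) ^ r * ((2 * r + 1).choose (r + 1) : ℚ) * ((eulerChar K : ℚ) - 2) =
    4 ^ (r + 1) * Ring.choose (((k : ℚ) - 1) / 2) (r + 1)

end General

/-- The equality part of Sparla's conjecture for `2r`-dimensional manifolds with `2k` vertices: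
a centrally symmetric combinatorial `2r`-manifold on exactly `2k` vertices attains equality
if and only if it contains the `r`-skeleton of the `k`-dimensional cross polytope. -/
def SparlaEqualityAssertion (r k : ℕ) : Prop :=
  ∀ (V : Type) [Fintype V] [DecidableEq V] (K : AbstractSimplicialComplex V) (α : V → V),
    Fintype.card V = 2 * k →
    IsCentrallySymmetric α K.toPreAbstractSimplicialComplex →
    IsCombinatorialManifold (2 * r) K.toPreAbstractSimplicialComplex →
    (SparlaEquality r k K.toPreAbstractSimplicialComplex ↔
      skeleton r (crossPolytope α) ≤ K.toPreAbstractSimplicialComplex)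

/-- The involution of the vertex set `{x_1, …, x_d, y_1, …, y_d}` exchanging `x_j` and `y_j`, where
`(j, true)` stands for `x_j` and `(j, false)` for `y_j`. -/
def antipode (d : ℕ) : Fin d × Bool → Fin d × Bool := fun v => (v.1, !v.2)

/-- The switch set of a word `u` in two letters: the positions `j` with `u_j ≠ u_{j+1}`. -/
def switchSet {d : ℕ} (u : Fin d → Bool) : Finset (Fin d) :=
  Finset.univ.filter fun j => ∃ h : (j : ℕ) + 1 < d, u j ≠ u ⟨(j : ℕ) + 1, h⟩

/-- The facet of the cross polytope encoded by a word. -/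
def facet {d : ℕ} (u : Fin d → Bool) : Finset (Fin d × Bool) :=
  Finset.univ.image fun j => (j, u j)

/-- The complex `B(i, d)`: the subcomplex of the boundary complex of the `d`-dimensional cross
polytope generated by the facets whose words have at most `i` switches. -/
def B (i d : ℕ) : PreAbstractSimplicialComplex (Fin d × Bool) where
  faces := {σ | σ.Nonempty ∧ ∃ u : Fin d → Bool, (switchSet u).card ≤ i ∧ σ ⊆ facet u}
  isRelLowerSet_faces := fun _ hs =>
    ⟨hs.1, fun _ hts ht => by
      obtain ⟨_, u, hu, hsub⟩ := hs
      exact ⟨ht, u, hu, hts.trans hsub⟩⟩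

/-- The boundary `∂B(i, d)` of the `(d - 1)`-dimensional complex `B(i, d)`. -/
def boundaryB (i d : ℕ) : PreAbstractSimplicialComplex (Fin d × Bool) :=
  boundary (d - 1) (B i d)

end SparlaCS

namespace SparlaCS

/-! ### Words and switches -/

section Words

variable {d : ℕ}

/-! Everything rests on one description of the complex: a nonempty set of vertices is a face of
`∂B(i,d)` exactly when it extends both to a word with at most `i` switches and to a word with more
than `i` (`mem_boundaryB`). Exchanging every other letter turns switches into non-switches, so these
two conditions are dual to each other.

Combinatorics. Complementing a word preserves its switches, which gives the central symmetry. An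
alternating pattern on `r + 1` consecutive positions forces `r > i` switches, so the `r`-skeleton is
not contained in the complex. The Euler characteristic is a signed count of partial words
(`sum_low`), completed by duality and inclusion-exclusion. For `k = 2r + 2` the right side of
Sparla's inequality is `C(2r+2, r+1) = 2 C(2r+1, r+1)`, so equality amounts to `χ - 2 = 2 (-1)^r`.

Topology. In the `ℓ¹` sphere of `ℝ^d` the realization is the set of vectors lying in both `lowVar`
and `highVar`, that is, whose zeros can be given signs so as to have at most `i` sign changes and
also so as to have more. This set is a transversal of a flow. If `A` is the adjacency matrix of a
path, `exp(tA)` diminishes sign variation, so an orbit passes from `highVar` to `lowVar` at most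
once (`linFlow_pathOp_notMem_highVar`). The eigenvectors, by decreasing eigenvalue, have exactly `0,
1, …, d - 1` sign changes (`exists_eigenbasis`). Hence an orbit with components among both the first
`i + 1` and the remaining eigenvectors does cross. It also crosses exactly once the cone on which
the two sums of squared eigencoordinates agree. Sliding along orbits and rescaling identifies the
two sections, and the second is visibly a product of spheres.

Links are treated by the same method (`nonempty_homeomorph_local`). The coordinates supporting the
face are frozen, a flow (`pullOp`) pulls the others from a frozen one, and a weighted dilation
replaces scaling. The variation boundary is then compared with a coordinate hyperplane, whose
section is a round sphere. -/

lemma mem_switchSet {u : Fin d → Bool} {j : Fin d} :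
    j ∈ switchSet u ↔ ∃ h : (j : ℕ) + 1 < d, u j ≠ u ⟨(j : ℕ) + 1, h⟩ := by
  simp [switchSet]

lemma exists_switch_of_ne (u : Fin d → Bool) {a b : Fin d} (hab : a ≤ b) (h : u a ≠ u b) :
    ∃ c ∈ switchSet u, a ≤ c ∧ c < b := by
  obtain ⟨b, hb⟩ := b
  induction b with
  | zero =>
    have : a = ⟨0, hb⟩ := Fin.ext (by simpa [Fin.le_def] using hab)
    exact absurd (by rw [this]) h
  | succ b ih =>
    have hab' : (a : ℕ) ≤ b + 1 := hab
    rcases Nat.lt_or_ge b a with hlt | hge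
    · have : a = ⟨b + 1, hb⟩ := Fin.ext (by simp; omega)
      exact absurd (by rw [this]) h
    · by_cases h' : u a = u ⟨b, by omega⟩
      · refine ⟨⟨b, by omega⟩, mem_switchSet.2 ⟨hb, ?_⟩, hge, ?_⟩
        · rw [← h']; exact h
        · simp [Fin.lt_def]
      · obtain ⟨c, hc, h1, h2⟩ := ih (by omega) hge h'
        refine ⟨c, hc, h1, h2.trans ?_⟩
        simp [Fin.lt_def]

/-- Precomposition with a monotone map does not create switches. -/
lemma card_switchSet_comp_le (u : Fin d → Bool) {f : Fin d → Fin d} (hf : Monotone f) :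
    (switchSet (u ∘ f)).card ≤ (switchSet u).card := by
  -- A switch `j` of `u ∘ f` is charged to a switch of `u` in the interval from `f j` to `f (j +
  -- 1)`. By monotonicity these half-open intervals do not overlap, so the charging is injective.
  have key : ∀ j ∈ switchSet (u ∘ f), ∃ c ∈ switchSet u, f j ≤ c ∧
      ∀ h : (j : ℕ) + 1 < d, c < f ⟨(j : ℕ) + 1, h⟩ := by
    intro j hj
    obtain ⟨h, hne⟩ := mem_switchSet.1 hj
    obtain ⟨c, hc, h1, h2⟩ := exists_switch_of_ne u (hf (show j ≤ ⟨(j : ℕ) + 1, h⟩ by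
      simp [Fin.le_def])) hne
    exact ⟨c, hc, h1, fun _ => h2⟩
  choose! g hg h1 h2 using key
  have hlt : ∀ a ∈ switchSet (u ∘ f), ∀ b ∈ switchSet (u ∘ f), a < b → g a < g b := by
    intro a ha b hb hab
    have h : (a : ℕ) + 1 < d := by have := b.2; have : (a : ℕ) < b := hab; omega
    exact (h2 a ha h).trans_le ((hf (show ⟨(a : ℕ) + 1, h⟩ ≤ b from hab)).trans (h1 b hb))
  refine Finset.card_le_card_of_injOn g hg fun a ha b hb hab => ?_
  rcases lt_trichotomy a b with h | h | h
  · exact absurd hab (hlt a ha b hb h).ne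
  · exact h
  · exact absurd hab (hlt b hb a ha h).ne'

/-- If every letter of `v` occurs in `u` at a place that depends monotonically on its position,
then `v` has at most as many switches as `u`. -/
lemma card_switchSet_le_of_rel (u v : Fin d → Bool) (R : Fin d → Fin d → Prop)
    (hR : ∀ j j' k k', j < j' → R j k → R j' k' → k ≤ k') (h : ∀ j, ∃ k, R j k ∧ v j = u k) :
    (switchSet v).card ≤ (switchSet u).card := by
  choose f hf hv using h
  have : v = u ∘ f := funext hv
  rw [this]
  refine card_switchSet_comp_le u fun a b hab => ?_
  rcases hab.eq_or_lt with rfl | hlt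
  · exact le_rfl
  · exact hR _ _ _ _ hlt (hf a) (hf b)

/-- The word with alternate letters exchanged. -/
def altWord (u : Fin d → Bool) : Fin d → Bool := fun j => xor (u j) (decide ((j : ℕ) % 2 = 1))

/-- Each of the `d` adjacent pairs is a switch of exactly one of the two words. This is the duality
`i ↔ d - 1 - i` between "at most `i`" and "more than `i`" switches. -/
lemma card_switchSet_altWord (u : Fin (d + 1) → Bool) :
    (switchSet (altWord u)).card + (switchSet u).card = d := by
  have hd : Disjoint (switchSet (altWord u)) (switchSet u) := by
    rw [Finset.disjoint_left]
    intro j h1 h2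
    obtain ⟨h, h1⟩ := mem_switchSet.1 h1
    obtain ⟨_, h2⟩ := mem_switchSet.1 h2
    simp only [altWord] at h1
    rcases Nat.mod_two_eq_zero_or_one (j : ℕ) with hj | hj
    · have : ((j : ℕ) + 1) % 2 = 1 := by omega
      simp only [hj, this] at h1
      revert h1 h2
      cases u j <;> cases u ⟨(j : ℕ) + 1, h⟩ <;> simp
    · have : ((j : ℕ) + 1) % 2 = 0 := by omega
      simp only [hj, this] at h1
      revert h1 h2
      cases u j <;> cases u ⟨(j : ℕ) + 1, h⟩ <;> simp
  have hu : switchSet (altWord u) ∪ switchSet u = Finset.univ.erase (Fin.last d) := by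
    ext j
    simp only [Finset.mem_union, Finset.mem_erase, Finset.mem_univ, and_true]
    constructor
    · rintro (h | h) <;> obtain ⟨h, -⟩ := mem_switchSet.1 h <;> rintro rfl <;> simp at h
    · intro hj
      have h : (j : ℕ) + 1 < d + 1 := by
        have : (j : ℕ) ≠ d := fun e => hj (Fin.ext e)
        omega
      simp only [mem_switchSet, altWord]
      by_cases he : u j = u ⟨(j : ℕ) + 1, h⟩
      · refine Or.inl ⟨h, ?_⟩
        rw [he]
        rcases Nat.mod_two_eq_zero_or_one (j : ℕ) with hj | hj
        · have : ((j : ℕ) + 1) % 2 = 1 := by omega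
          simp [hj, this]
        · have : ((j : ℕ) + 1) % 2 = 0 := by omega
          simp [hj, this]
      · exact Or.inr ⟨h, he⟩
  rw [← Finset.card_union_of_disjoint hd, hu]
  simp

lemma card_switchSet_le (u : Fin (d + 1) → Bool) : (switchSet u).card ≤ d := by
  have := card_switchSet_altWord u
  omega

lemma card_switchSet_not (u : Fin d → Bool) : switchSet (fun j => !u j) = switchSet u := by
  ext j; simp [mem_switchSet]

lemma card_switchSet_const (b : Bool) : (switchSet (fun _ : Fin d => b)).card = 0 := by
  rw [Finset.card_eq_zero]
  ext j; simp [mem_switchSet]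

lemma card_switchSet_cons_zero (b : Bool) (u : Fin 0 → Bool) :
    (switchSet (Fin.cons b u : Fin 1 → Bool)).card = 0 := by
  have := card_switchSet_le (Fin.cons b u : Fin 1 → Bool)
  omega

lemma card_switchSet_cons (b : Bool) (u : Fin (d + 1) → Bool) :
    (switchSet (Fin.cons b u : Fin (d + 2) → Bool)).card =
      (switchSet u).card + if b = u 0 then 0 else 1 := by
  simp only [switchSet, Finset.card_filter]
  rw [Fin.sum_univ_succ, add_comm]
  congr 1
  · refine Finset.sum_congr rfl fun j _ => ?_
    congr 1
    have : ((Fin.cons b u : Fin (d + 2) → Bool) j.succ) = u j := rfl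
    simp only [this, Fin.val_succ, eq_iff_iff]
    constructor
    · rintro ⟨h, hne⟩
      exact ⟨by omega, hne⟩
    · rintro ⟨h, hne⟩
      exact ⟨by omega, hne⟩
  · have : (Fin.cons b u : Fin (d + 2) → Bool) ⟨((0 : Fin (d + 2)) : ℕ) + 1, by simp⟩ = u 0 := rfl
    by_cases h : b = u 0
    · simp only [h, if_true]
      rw [if_neg]
      rintro ⟨_, hne⟩
      exact hne rfl
    · rw [if_neg h, if_pos]
      exact ⟨by simp, h⟩

end Words

/-! ### The faces of the boundary complex -/

section Faces

variable {d : ℕ}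

lemma mem_facet {u : Fin d → Bool} {p : Fin d × Bool} : p ∈ facet u ↔ u p.1 = p.2 := by
  obtain ⟨j, b⟩ := p
  simp [facet]

lemma card_facet (u : Fin d → Bool) : (facet u).card = d := by
  rw [facet, Finset.card_image_of_injective _ (fun a b h => (Prod.ext_iff.1 h).1)]
  simp

lemma facet_injective : Function.Injective (facet : (Fin d → Bool) → Finset (Fin d × Bool)) := by
  intro u v h
  funext j
  have : (j, u j) ∈ facet v := by rw [← h]; exact mem_facet.2 rfl
  exact (mem_facet.1 this).symm

/-- A ridge of the cross polytope lies in two facets, whose words differ in one letter. It is a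
boundary ridge when just one of the two words has at most `i` switches, which gives the forward
direction. Conversely, while one word over `σ` is changed into another letter by letter, the bound
`i` must be crossed at some step, and the ridge shared by the two facets of that step contains `σ`.
-/
lemma mem_boundaryB (i d : ℕ) (σ : Finset (Fin (d + 1) × Bool)) :
    σ ∈ (boundaryB i (d + 1)).faces ↔ σ.Nonempty ∧
      (∃ u, (switchSet u).card ≤ i ∧ σ ⊆ facet u) ∧
      (∃ u, i < (switchSet u).card ∧ σ ⊆ facet u) := by
  constructor
  · rintro ⟨hne, τ, ⟨-, u, hu, hτu⟩, hτ, hστ, huniq⟩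
    refine ⟨hne, ⟨u, hu, hστ.trans hτu⟩, ?_⟩
    simp only [Nat.add_sub_cancel] at hτ huniq
    have hex : ∃ p ∈ facet u, p ∉ τ := by
      by_contra! hcon
      have := Finset.card_le_card (show facet u ⊆ τ from hcon)
      rw [card_facet, hτ] at this
      omega
    obtain ⟨⟨j, b⟩, hp, hpτ⟩ := hex
    have hb : u j = b := mem_facet.1 hp
    refine ⟨Function.update u j (!b), ?_, ?_⟩
    · by_contra! hcon
      have hsub : τ ⊆ facet (Function.update u j (!b)) := by
        intro q hq
        have hqu := mem_facet.1 (hτu hq)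
        rw [mem_facet]
        have : q.1 ≠ j := by
          intro e
          apply hpτ
          have : q = (j, b) := Prod.ext e (by rw [← hqu, e, hb])
          rwa [← this]
        rw [Function.update_of_ne this, hqu]
      obtain ⟨F, -, hF⟩ := huniq
      have h1 := hF (facet u) ⟨⟨⟨_, hp⟩, u, hu, subset_rfl⟩, card_facet u, hτu⟩
      have h2 := hF (facet (Function.update u j (!b)))
        ⟨⟨⟨(j, !b), by simp [mem_facet]⟩, _, hcon, subset_rfl⟩, card_facet _, hsub⟩
      have h3 := congrFun (facet_injective (h1.trans h2.symm)) j
      simp [hb] at h3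
    · intro q hq
      have hqu := mem_facet.1 (hτu (hστ hq))
      rw [mem_facet]
      have : q.1 ≠ j := by
        intro e
        apply hpτ
        have : q = (j, b) := Prod.ext e (by rw [← hqu, e, hb])
        rw [← this]
        exact hστ hq
      rw [Function.update_of_ne this, hqu]
  · rintro ⟨hne, ⟨u, hu, hσu⟩, ⟨v, hv, hσv⟩⟩
    -- pass from `u` to `v` one letter at a time
    let h : ℕ → Fin (d + 1) → Bool := fun k j => if (j : ℕ) < k then v j else u j
    have hσh : ∀ k, σ ⊆ facet (h k) := by
      intro k q hq
      rw [mem_facet]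
      simp only [h]
      split_ifs
      · exact mem_facet.1 (hσv hq)
      · exact mem_facet.1 (hσu hq)
    have h0 : h 0 = u := by funext j; simp [h]
    have h1 : h (d + 1) = v := by funext j; simp only [h]; rw [if_pos j.2]
    have hstep : ∃ k < d + 1, (switchSet (h k)).card ≤ i ∧ i < (switchSet (h (k + 1))).card := by
      by_contra! hcon
      have : ∀ k ≤ d + 1, (switchSet (h k)).card ≤ i := by
        intro k hk
        induction k with
        | zero => rwa [h0]
        | succ k ih => exact hcon k (by omega) (ih (by omega))
      have := this (d + 1) le_rfl
      rw [h1] at this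
      omega
    obtain ⟨k, hk, hle, hlt⟩ := hstep
    have hother : ∀ j : Fin (d + 1), j ≠ ⟨k, hk⟩ → h (k + 1) j = h k j := by
      intro j hj
      have : (j : ℕ) ≠ k := fun e => hj (Fin.ext e)
      simp only [h]
      by_cases hjk : (j : ℕ) < k
      · rw [if_pos (by omega), if_pos hjk]
      · rw [if_neg (by omega), if_neg hjk]
    have hnek : h (k + 1) ⟨k, hk⟩ ≠ h k ⟨k, hk⟩ := by
      intro e
      have : h (k + 1) = h k := by
        funext j
        by_cases hj : j = ⟨k, hk⟩
        · rw [hj, e]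
        · exact hother j hj
      rw [this] at hlt
      omega
    set c : Fin (d + 1) := ⟨k, hk⟩
    have hcard : ((facet (h k)).erase (c, h k c)).card = d := by
      rw [Finset.card_erase_of_mem (mem_facet.2 rfl), card_facet]; rfl
    have hstau : σ ⊆ (facet (h k)).erase (c, h k c) := by
      intro q hq
      refine Finset.mem_erase.2 ⟨?_, hσh k hq⟩
      rintro rfl
      exact hnek (mem_facet.1 (hσh (k + 1) hq))
    refine ⟨hne, (facet (h k)).erase (c, h k c), ⟨hne.mono hstau, h k, hle, Finset.erase_subset _ _⟩,
      hcard, hstau, facet (h k), ⟨⟨hne.mono (hσh k), h k, hle, subset_rfl⟩, card_facet _,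
        Finset.erase_subset _ _⟩, ?_⟩
    -- The only words over this ridge are `h k` and `h (k + 1)`, and the second has too many
    -- switches.
    rintro F ⟨⟨-, w, hw, hFw⟩, hFc, hF⟩
    have hFw' : F = facet w := Finset.eq_of_subset_of_card_le hFw (by
      rw [card_facet, hFc]; rfl)
    subst hFw'
    have hwj : ∀ j, j ≠ c → w j = h k j := by
      intro j hj
      have : (j, h k j) ∈ facet w := hF (Finset.mem_erase.2
        ⟨fun e => hj (Prod.ext_iff.1 e).1, mem_facet.2 rfl⟩)
      exact mem_facet.1 this
    by_cases hwc : w c = h k c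
    · congr 1
      funext j
      by_cases hj : j = c
      · rw [hj, hwc]
      · exact hwj j hj
    · exfalso
      have : w = h (k + 1) := by
        funext j
        by_cases hj : j = c
        · subst hj
          revert hwc hnek
          cases w c <;> cases h k c <;> cases h (k + 1) c <;> simp
        · rw [hwj j hj, hother j hj]
      rw [this] at hw
      omega

end Faces

/-! ### Vertices, central symmetry, and the equality in Sparla's inequality -/

section Elementary

variable {d : ℕ}

lemma card_switchSet_altWord_const (b : Bool) :
    (switchSet (altWord (fun _ : Fin (d + 1) => b))).card = d := by
  have := card_switchSet_altWord (fun _ : Fin (d + 1) => b)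
  rwa [card_switchSet_const] at this

lemma singleton_mem_boundaryB {i : ℕ} (hi : i < d) (p : Fin (d + 1) × Bool) :
    {p} ∈ (boundaryB i (d + 1)).faces := by
  rw [mem_boundaryB]
  refine ⟨Finset.singleton_nonempty p, ⟨fun _ => p.2, ?_, ?_⟩, ?_⟩
  · rw [card_switchSet_const]; omega
  · simp [mem_facet]
  -- The constant is chosen so that the alternating word has the letter `p.2` at position `p.1`.
  · refine ⟨altWord (fun _ => xor p.2 (decide ((p.1 : ℕ) % 2 = 1))), ?_, ?_⟩
    · rw [card_switchSet_altWord_const]; exact hi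
    · simp [mem_facet, altWord]

lemma ncard_vertices_boundaryB {i : ℕ} (hi : i < d) :
    (vertices (boundaryB i (d + 1))).ncard = 2 * (d + 1) := by
  have : vertices (boundaryB i (d + 1)) = Set.univ :=
    Set.eq_univ_of_forall fun p => singleton_mem_boundaryB hi p
  rw [this, Set.ncard_univ, Nat.card_eq_fintype_card]
  simp [mul_comm]

lemma image_antipode_subset_facet {σ : Finset (Fin d × Bool)} {u : Fin d → Bool}
    (h : σ ⊆ facet u) : σ.image (antipode d) ⊆ facet (fun j => !u j) := by
  intro p hp
  obtain ⟨q, hq, rfl⟩ := Finset.mem_image.1 hp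
  have := mem_facet.1 (h hq)
  simp [mem_facet, antipode, this]

lemma isCentrallySymmetric_boundaryB (i d : ℕ) :
    IsCentrallySymmetric (antipode (d + 1)) (boundaryB i (d + 1)) := by
  refine ⟨fun p => by simp [antipode], fun σ hσ => ?_⟩
  rw [mem_boundaryB] at hσ ⊢
  obtain ⟨⟨p, hp⟩, ⟨u, hu, hσu⟩, ⟨v, hv, hσv⟩⟩ := hσ
  refine ⟨⟨⟨_, Finset.mem_image_of_mem _ hp⟩,
    ⟨_, by rwa [card_switchSet_not], image_antipode_subset_facet hσu⟩,
    ⟨_, by rwa [card_switchSet_not], image_antipode_subset_facet hσv⟩⟩, fun he => ?_⟩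
  have h1 := mem_facet.1 (hσu hp)
  have h2 : antipode (d + 1) p ∈ σ := by
    rw [← he]; exact Finset.mem_image_of_mem _ hp
  have h3 := mem_facet.1 (hσu h2)
  simp [antipode, h1] at h3

/-- The missing face is the alternating pattern on the first `r + 1` positions: it has `r + 1`
vertices and no antipodal pair, but every word extending it has at least `r` switches. -/
lemma not_skeleton_le_boundaryB {i r : ℕ} (hir : i < r) :
    ¬ skeleton r (crossPolytope (antipode (2 * r + 2))) ≤ boundaryB i (2 * r + 2) := by
  intro h
  set a : Fin (2 * r + 2) → Bool := altWord fun _ => true with ha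
  set σ : Finset (Fin (2 * r + 2) × Bool) := (facet a).filter fun p => (p.1 : ℕ) ≤ r with hσ
  have hmem : ∀ p, p ∈ σ ↔ a p.1 = p.2 ∧ (p.1 : ℕ) ≤ r := by
    intro p; rw [hσ, Finset.mem_filter, mem_facet]
  have hcard : σ.card ≤ r + 1 := by
    rw [← Finset.card_range (r + 1)]
    refine Finset.card_le_card_of_injOn (fun p => (p.1 : ℕ)) (fun p hp => ?_)
      fun p hp q hq hpq => ?_
    · have := ((hmem p).1 hp).2
      simp; omega
    · have e : p.1 = q.1 := Fin.ext hpq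
      refine Prod.ext e ?_
      rw [← ((hmem p).1 hp).1, ← ((hmem q).1 hq).1, e]
  have hf : σ ∈ (skeleton r (crossPolytope (antipode (2 * r + 2)))).faces := by
    refine ⟨⟨⟨((0 : Fin (2 * r + 2)), a 0), (hmem _).2 ⟨rfl, by simp⟩⟩, fun p hp hq => ?_⟩, hcard⟩
    have h1 := ((hmem p).1 hp).1
    have h2 := ((hmem _).1 hq).1
    simp [antipode, h1] at h2
  obtain ⟨-, ⟨u, hu, hσu⟩, -⟩ := (mem_boundaryB i (2 * r + 1) σ).1 (h hf)
  have hua : ∀ j : Fin (2 * r + 2), (j : ℕ) ≤ r → u j = a j := fun j hj =>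
    mem_facet.1 (hσu ((hmem (j, a j)).2 ⟨rfl, hj⟩))
  have hle : (Finset.univ : Finset (Fin r)).card ≤ (switchSet u).card := by
    refine Finset.card_le_card_of_injOn
      (fun k : Fin r => (⟨(k : ℕ), by omega⟩ : Fin (2 * r + 2))) (fun k _ => ?_)
      (fun k _ l _ hkl => Fin.ext (by simpa using hkl))
    have hk := k.2
    refine mem_switchSet.2 ⟨by simp; omega, ?_⟩
    rw [hua _ (by simp only []; omega), hua _ (by simp only []; omega)]
    rcases Nat.mod_two_eq_zero_or_one (k : ℕ) with hj | hj
    · have : ((k : ℕ) + 1) % 2 = 1 := by omega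
      simp [ha, altWord, hj, this]
    · have : ((k : ℕ) + 1) % 2 = 0 := by omega
      simp [ha, altWord, hj, this]
  rw [Finset.card_univ, Fintype.card_fin] at hle
  omega

/-- After division by `(n!)²` this reads `4^n C(n - 1/2, n) = C(2n, n)`. It is needed for `n = r +
1`, because `(k - 1)/2 = (r + 1) - 1/2` when `k = 2r + 2`. -/
lemma smeval_descPochhammer_sub_half (n : ℕ) :
    4 ^ n * (descPochhammer ℤ n).smeval ((n : ℚ) - 1 / 2) * n.factorial = (2 * n).factorial := by
  induction n with
  | zero => simp
  | succ n ih =>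
    rw [descPochhammer_succ_left, Polynomial.smeval_mul, Polynomial.smeval_X,
      Polynomial.smeval_comp, Polynomial.smeval_sub, Polynomial.smeval_X, Polynomial.smeval_one]
    have e : (((n + 1 : ℕ) : ℚ) - 1 / 2) ^ 1 - 1 • (((n + 1 : ℕ) : ℚ) - 1 / 2) ^ 0 =
        (n : ℚ) - 1 / 2 := by push_cast; simp; ring
    rw [e, show 2 * (n + 1) = 2 * n + 1 + 1 by ring, Nat.factorial_succ, Nat.factorial_succ,
      Nat.factorial_succ]
    push_cast
    rw [← ih]
    ring

lemma sparlaEquality_of_eulerChar {r i : ℕ} (hi : i % 2 = r % 2)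
    {K : PreAbstractSimplicialComplex (Fin (2 * r + 2) × Bool)}
    (hK : eulerChar K - 2 = 2 * (-1) ^ i) : SparlaEquality r (2 * r + 2) K := by
  have hpow : (-1 : ℚ) ^ i = (-1) ^ r := by
    rw [← Nat.div_add_mod i 2, ← Nat.div_add_mod r 2, pow_add, pow_add, pow_mul, pow_mul, hi]
    simp
  have hK' : (eulerChar K : ℚ) - 2 = 2 * (-1) ^ r := by
    rw [← hpow]; exact_mod_cast hK
  have hsq : (-1 : ℚ) ^ r * (-1) ^ r = 1 := by rw [← mul_pow]; simp
  have hk : (((2 * r + 2 : ℕ) : ℚ) - 1) / 2 = ((r + 1 : ℕ) : ℚ) - 1 / 2 := by push_cast; ring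
  have hfac := smeval_descPochhammer_sub_half (r + 1)
  have hch : (2 * (r + 1)).factorial =
      2 * (2 * r + 1).choose (r + 1) * ((r + 1).factorial * (r + 1).factorial) := by
    have h1 := Nat.choose_mul_factorial_mul_factorial (show r + 1 ≤ 2 * (r + 1) by omega)
    have h2 : (2 * (r + 1)).choose (r + 1) = 2 * (2 * r + 1).choose (r + 1) := by
      rw [show 2 * (r + 1) = 2 * r + 1 + 1 by ring, Nat.choose_succ_succ, Nat.choose_symm_half]
      ring
    rw [h2, show 2 * (r + 1) - (r + 1) = r + 1 by omega] at h1
    rw [← h1]; ring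
  rw [hch] at hfac
  have hpos : ((r + 1).factorial : ℚ) ≠ 0 := by exact_mod_cast (r + 1).factorial_ne_zero
  rw [SparlaEquality, hK', Ring.choose_eq_smul, hk, smul_eq_mul]
  generalize (descPochhammer ℤ (r + 1)).smeval (((r + 1 : ℕ) : ℚ) - 1 / 2) = D at hfac ⊢
  push_cast at hfac ⊢
  field_simp
  refine mul_right_cancel₀ hpos ?_
  linear_combination 2 * ((r + 1).factorial : ℚ) ^ 2 * ((2 * r + 1).choose (r + 1) : ℚ) * hsq - hfac

end Elementary

/-! ### The Euler characteristic -/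

section Euler

open Finset

open scoped Classical in
lemma eulerChar_eq_sum {V : Type*} [Fintype V] (K : PreAbstractSimplicialComplex V) :
    eulerChar K = -∑ σ : Finset V with σ ∈ K.faces, (-1 : ℤ) ^ σ.card := by
  have hf : ∀ j, (faceNumber K j : ℤ) =
      ∑ σ : Finset V with σ ∈ K.faces, if σ.card = j + 1 then 1 else 0 := by
    intro j
    rw [faceNumber, Finset.sum_boole, Finset.filter_filter, ← Set.ncard_coe_finset]
    simp
  simp only [eulerChar, hf, Finset.mul_sum]
  rw [Finset.sum_comm, ← Finset.sum_neg_distrib]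
  refine Finset.sum_congr rfl fun σ hσ => ?_
  have hpos : 0 < σ.card := (K.isRelLowerSet_faces (Finset.mem_filter.1 hσ).2).1.card_pos
  have hle : σ.card ≤ Fintype.card V := Finset.card_le_univ σ
  rw [Finset.sum_eq_single_of_mem (σ.card - 1) (by simp; omega)]
  · rw [if_pos (by omega), mul_one]
    obtain ⟨m, hm⟩ : ∃ m, σ.card = m + 1 := ⟨σ.card - 1, by omega⟩
    rw [hm, pow_succ]; simp
  · intro b _ hb
    rw [if_neg (by omega), mul_zero]

/-- The word `u` extends the partial word `e`. -/
def Extends {n : ℕ} (e : Fin n → Option Bool) (u : Fin n → Bool) : Prop :=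
  ∀ j b, e j = some b → u j = b

/-- The sign of a letter of a partial word. -/
def letterSign (o : Option Bool) : ℤ := if o = none then 1 else -1

variable {n : ℕ}

lemma extends_cons {o : Option Bool} {e : Fin n → Option Bool} {b : Bool} {u : Fin n → Bool} :
    Extends (Fin.cons o e : Fin (n + 1) → Option Bool) (Fin.cons b u : Fin (n + 1) → Bool) ↔
      (∀ c, o = some c → b = c) ∧ Extends e u := by
  simp [Extends, Fin.forall_fin_succ]

/-- A first letter left open has weight `1` and each of the two actual letters has weight `-1`. All
signed counts below are recursions on this identity. -/
lemma sum_letterSign_succ (f : (Fin (n + 1) → Option Bool) → ℤ) :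
    ∑ e, (∏ j, letterSign (e j)) * f e = ∑ e : Fin n → Option Bool, (∏ j, letterSign (e j)) *
      (f (Fin.cons none e) - f (Fin.cons (some true) e) - f (Fin.cons (some false) e)) := by
  rw [← (Fin.consEquiv (fun _ => Option Bool)).sum_comp, Fintype.sum_prod_type, Finset.sum_comm]
  refine Finset.sum_congr rfl fun e _ => ?_
  simp only [Fin.consEquiv_apply, Fin.prod_univ_succ, Fin.cons_zero, Fin.cons_succ,
    Fintype.sum_option, Fintype.sum_bool]
  simp only [letterSign, if_true, reduceCtorEq, if_false]
  change _ * f (Fin.cons none e) + (_ * f (Fin.cons (some true) e) +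
    _ * f (Fin.cons (some false) e)) = _
  ring

lemma sum_letterSign (n : ℕ) :
    ∑ e : Fin n → Option Bool, ∏ j, letterSign (e j) = (-1) ^ n := by
  induction n with
  | zero => simp
  | succ n ih =>
    have := sum_letterSign_succ (n := n) (fun _ => 1)
    simp only [mul_one] at this
    rw [this, ← Finset.sum_mul, ih]
    ring

/-- Some extension of `e`, with the letter `a` put in front, has at most `i` switches. -/
def LowFrom (a : Bool) (i : ℕ) (e : Fin n → Option Bool) : Prop :=
  ∃ u : Fin n → Bool, Extends e u ∧ (switchSet (Fin.cons a u : Fin (n + 1) → Bool)).card ≤ i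

lemma card_switchSet_cons_le (a b : Bool) (u : Fin n → Bool) :
    (switchSet (Fin.cons a u : Fin (n + 1) → Bool)).card ≤
      (switchSet (Fin.cons b u : Fin (n + 1) → Bool)).card + if a = b then 0 else 1 := by
  cases n with
  | zero => rw [card_switchSet_cons_zero]; omega
  | succ n =>
    rw [card_switchSet_cons, card_switchSet_cons]
    cases a <;> cases b <;> cases u 0 <;> simp [add_assoc]

/-- An open letter is best filled by a copy of its predecessor, and deleting a letter never creates
a switch. -/
lemma lowFrom_cons_none (a : Bool) (i : ℕ) (e : Fin n → Option Bool) :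
    LowFrom a i (Fin.cons none e : Fin (n + 1) → Option Bool) ↔ LowFrom a i e := by
  constructor
  · rintro ⟨u, hu, hi⟩
    induction u using Fin.consCases with
    | cons b u =>
      refine ⟨u, (extends_cons.1 hu).2, (card_switchSet_cons_le a b u).trans ?_⟩
      rwa [card_switchSet_cons] at hi
  · rintro ⟨u, hu, hi⟩
    refine ⟨Fin.cons a u, extends_cons.2 ⟨by simp, hu⟩, ?_⟩
    rw [card_switchSet_cons]
    simpa using hi

lemma lowFrom_cons_some (a b : Bool) (i : ℕ) (e : Fin n → Option Bool) :
    LowFrom a i (Fin.cons (some b) e : Fin (n + 1) → Option Bool) ↔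
      if a = b then LowFrom a i e else 1 ≤ i ∧ LowFrom b (i - 1) e := by
  have h : LowFrom a i (Fin.cons (some b) e : Fin (n + 1) → Option Bool) ↔
      ∃ u, Extends e u ∧
        (switchSet (Fin.cons b u : Fin (n + 1) → Bool)).card + (if a = b then 0 else 1) ≤ i := by
    constructor
    · rintro ⟨u, hu, hi⟩
      induction u using Fin.consCases with
      | cons c u =>
        obtain ⟨h1, h2⟩ := extends_cons.1 hu
        obtain rfl := h1 b rfl
        refine ⟨u, h2, ?_⟩
        rwa [card_switchSet_cons] at hi
    · rintro ⟨u, hu, hi⟩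
      refine ⟨Fin.cons b u, extends_cons.2 ⟨by simp, hu⟩, ?_⟩
      rwa [card_switchSet_cons]
  rw [h]
  split_ifs with hab
  · subst hab; rfl
  · constructor
    · rintro ⟨u, hu, hi⟩
      exact ⟨by omega, u, hu, by omega⟩
    · rintro ⟨h1, u, hu, hi⟩
      exact ⟨u, hu, by omega⟩

open scoped Classical in
-- An open first letter and a first letter equal to `a` impose the same condition with opposite
-- signs and cancel. Only the opposite letter survives; it costs one switch and one sign, so the sum
-- for `(n + 1, i)` is minus the sum for `(n, i - 1)`, and it vanishes when `i = 0`.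
lemma sum_lowFrom (n : ℕ) : ∀ (a : Bool) (i : ℕ),
    ∑ e : Fin n → Option Bool, (∏ j, letterSign (e j)) * (if LowFrom a i e then 1 else 0) =
      if n ≤ i then (-1) ^ n else 0 := by
  induction n with
  | zero =>
    intro a i
    have : ∀ e : Fin 0 → Option Bool, LowFrom a i e := fun e =>
      ⟨Fin.elim0, fun j => j.elim0, by rw [card_switchSet_cons_zero]; omega⟩
    simp [this]
  | succ n ih =>
    intro a i
    rw [sum_letterSign_succ]
    have hstep : ∀ e : Fin n → Option Bool,
        ((if LowFrom a i (Fin.cons none e : Fin (n + 1) → Option Bool) then (1 : ℤ) else 0) -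
          (if LowFrom a i (Fin.cons (some true) e : Fin (n + 1) → Option Bool) then 1 else 0) -
          (if LowFrom a i (Fin.cons (some false) e : Fin (n + 1) → Option Bool) then 1 else 0)) =
        -(if 1 ≤ i ∧ LowFrom (!a) (i - 1) e then 1 else 0) := by
      intro e
      rw [lowFrom_cons_none, lowFrom_cons_some, lowFrom_cons_some]
      cases a <;> simp
    simp only [hstep]
    rcases Nat.eq_zero_or_pos i with rfl | hi
    · simp
    · have : ∀ e : Fin n → Option Bool, (1 ≤ i ∧ LowFrom (!a) (i - 1) e) = LowFrom (!a) (i - 1) e :=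
        fun e => by simp [show 1 ≤ i from hi]
      simp only [this, mul_neg, Finset.sum_neg_distrib, ih]
      by_cases h : n ≤ i - 1
      · rw [if_pos h, if_pos (by omega), pow_succ]; ring
      · rw [if_neg h, if_neg (by omega)]; simp

/-- Some extension of `e` has at most `i` switches. -/
def Low (i : ℕ) (e : Fin n → Option Bool) : Prop :=
  ∃ u : Fin n → Bool, Extends e u ∧ (switchSet u).card ≤ i

/-- Some extension of `e` has more than `i` switches. -/
def High (i : ℕ) (e : Fin n → Option Bool) : Prop :=
  ∃ u : Fin n → Bool, Extends e u ∧ i < (switchSet u).card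

lemma low_cons_none (i : ℕ) (e : Fin n → Option Bool) :
    Low i (Fin.cons none e : Fin (n + 1) → Option Bool) ↔ Low i e := by
  constructor
  · rintro ⟨u, hu, hi⟩
    induction u using Fin.consCases with
    | cons b u =>
      refine ⟨u, (extends_cons.1 hu).2, le_trans ?_ hi⟩
      cases n with
      | zero => rw [card_switchSet_cons_zero]; simp [switchSet]
      | succ n => rw [card_switchSet_cons]; omega
  · rintro ⟨u, hu, hi⟩
    cases n with
    | zero =>
      exact ⟨Fin.cons true u, extends_cons.2 ⟨by simp, hu⟩, by
        rw [card_switchSet_cons_zero]; omega⟩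
    | succ n =>
      refine ⟨Fin.cons (u 0) u, extends_cons.2 ⟨by simp, hu⟩, ?_⟩
      rw [card_switchSet_cons]
      simpa using hi

lemma low_cons_some (i : ℕ) (b : Bool) (e : Fin n → Option Bool) :
    Low i (Fin.cons (some b) e : Fin (n + 1) → Option Bool) ↔ LowFrom b i e := by
  constructor
  · rintro ⟨u, hu, hi⟩
    induction u using Fin.consCases with
    | cons c u =>
      obtain ⟨h1, h2⟩ := extends_cons.1 hu
      obtain rfl := h1 b rfl
      exact ⟨u, h2, hi⟩
  · rintro ⟨u, hu, hi⟩
    exact ⟨Fin.cons b u, extends_cons.2 ⟨by simp, hu⟩, hi⟩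

open scoped Classical in
-- With `S(n)` for this sum and `L(n)` for that of `sum_lowFrom`, splitting off the first letter
-- gives `S(n + 1) = S(n) - 2 L(n)`. As `L(n)` is zero for `n > i`, the sum is constant in `n`
-- beyond `i`.
lemma sum_low (n i : ℕ) :
    ∑ e : Fin n → Option Bool, (∏ j, letterSign (e j)) * (if Low i e then 1 else 0) =
      if i < n then -(-1) ^ i else (-1) ^ n := by
  induction n with
  | zero =>
    have : ∀ e : Fin 0 → Option Bool, Low i e := fun e =>
      ⟨Fin.elim0, fun j => j.elim0, by simp [switchSet]⟩
    simp [this]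
  | succ n ih =>
    rw [sum_letterSign_succ]
    simp only [low_cons_none, low_cons_some, mul_sub, Finset.sum_sub_distrib, ih, sum_lowFrom]
    rcases lt_trichotomy i n with h | rfl | h
    · rw [if_pos h, if_neg (by omega), if_pos (by omega)]; ring
    · simp
    · rw [if_neg (by omega), if_pos (by omega), if_neg (by omega), pow_succ]; ring

/-- Exchanging alternate letters of a partial word. -/
def altPartial (e : Fin n → Option Bool) : Fin n → Option Bool :=
  fun j => (e j).map fun b => xor b (decide ((j : ℕ) % 2 = 1))

lemma altPartial_altPartial (e : Fin n → Option Bool) : altPartial (altPartial e) = e := by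
  funext j
  cases h : e j <;> simp [altPartial, h]

lemma Extends.alt {e : Fin n → Option Bool} {u : Fin n → Bool} (h : Extends e u) :
    Extends (altPartial e) (altWord u) := by
  intro j b hb
  simp only [altPartial, Option.map_eq_some_iff] at hb
  obtain ⟨c, hc, rfl⟩ := hb
  simp [altWord, h j c hc]

lemma high_iff_low_altPartial {d i : ℕ} (hi : i < d) (e : Fin (d + 1) → Option Bool) :
    High i e ↔ Low (d - 1 - i) (altPartial e) := by
  constructor
  · rintro ⟨u, hu, h⟩
    have := card_switchSet_altWord u
    exact ⟨altWord u, hu.alt, by omega⟩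
  · rintro ⟨u, hu, h⟩
    have := card_switchSet_altWord u
    refine ⟨altWord u, ?_, by omega⟩
    have h2 := hu.alt
    rwa [altPartial_altPartial] at h2

open scoped Classical in
-- Exchanging alternate letters preserves the set of open positions, hence the sign, and reduces the
-- count to `sum_low` with `d - 1 - i` switches.
lemma sum_high {d i : ℕ} (hi : i < d) :
    ∑ e : Fin (d + 1) → Option Bool, (∏ j, letterSign (e j)) * (if High i e then 1 else 0) =
      -(-1) ^ (d - 1 - i) := by
  have h := sum_low (d + 1) (d - 1 - i)
  rw [if_pos (by omega)] at h
  rw [← h]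
  refine Fintype.sum_equiv (Function.Involutive.toPerm _ altPartial_altPartial) _ _ fun e => ?_
  have hs : ∏ j, letterSign (e j) = ∏ j, letterSign (altPartial e j) :=
    Finset.prod_congr rfl fun j _ => by simp [letterSign, altPartial]
  rw [hs]
  simp only [high_iff_low_altPartial hi]
  rfl

open scoped Classical in
-- Inclusion-exclusion: any filling of a partial word shows it to be low or high, so the union
-- contributes the full sum `sum_letterSign`.
lemma sum_low_and_high {d i : ℕ} (hi : i < d) :
    ∑ e : Fin (d + 1) → Option Bool, (∏ j, letterSign (e j)) *
      (if Low i e ∧ High i e then 1 else 0) =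
      -(-1) ^ i - (-1) ^ (d - 1 - i) + (-1) ^ d := by
  have h1 := sum_low (d + 1) i
  rw [if_pos (by omega)] at h1
  have h : ∀ e : Fin (d + 1) → Option Bool, (if Low i e ∧ High i e then (1 : ℤ) else 0) =
      (if Low i e then 1 else 0) + (if High i e then 1 else 0) - 1 := by
    intro e
    have : Low i e ∨ High i e := by
      have hu : Extends e fun j => (e j).getD true := fun j b hb => by simp [hb]
      rcases le_or_gt (switchSet fun j => (e j).getD true).card i with h | h
      · exact Or.inl ⟨_, hu, h⟩
      · exact Or.inr ⟨_, hu, h⟩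
    by_cases hl : Low i e <;> by_cases hh : High i e <;> simp_all
  simp only [h, mul_sub, mul_add, Finset.sum_sub_distrib, Finset.sum_add_distrib, h1, sum_high hi,
    mul_one, sum_letterSign]
  rw [pow_succ]; ring

/-- The set of vertices of the cross polytope encoded by a partial word. -/
def partialFace (e : Fin n → Option Bool) : Finset (Fin n × Bool) :=
  univ.filter fun p => e p.1 = some p.2

lemma mem_partialFace {e : Fin n → Option Bool} {p : Fin n × Bool} :
    p ∈ partialFace e ↔ e p.1 = some p.2 := by simp [partialFace]

lemma partialFace_subset_facet {e : Fin n → Option Bool} {u : Fin n → Bool} :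
    partialFace e ⊆ facet u ↔ Extends e u := by
  constructor
  · intro h j b hb
    exact mem_facet.1 (h (mem_partialFace.2 hb : (j, b) ∈ partialFace e))
  · intro h p hp
    exact mem_facet.2 (h _ _ (mem_partialFace.1 hp))

lemma partialFace_injective :
    Function.Injective (partialFace : (Fin n → Option Bool) → Finset (Fin n × Bool)) := by
  intro e f h
  funext j
  refine Option.ext fun b => ?_
  have := Finset.ext_iff.1 h (j, b)
  simpa [mem_partialFace] using this

lemma prod_letterSign (e : Fin n → Option Bool) :
    ∏ j, letterSign (e j) = (-1) ^ (partialFace e).card := by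
  rw [partialFace, ← Finset.prod_const, Finset.prod_filter, Fintype.prod_prod_type]
  refine Finset.prod_congr rfl fun j _ => ?_
  cases h : e j with
  | none => simp [letterSign, h]
  | some b => cases b <;> simp [letterSign, h]

lemma exists_partialFace_eq {σ : Finset (Fin n × Bool)} {u : Fin n → Bool} (h : σ ⊆ facet u) :
    ∃ e, partialFace e = σ := by
  classical
  refine ⟨fun j => if (j, u j) ∈ σ then some (u j) else none, ?_⟩
  ext ⟨j, b⟩
  rw [mem_partialFace]
  constructor
  · intro hb
    by_cases hj : (j, u j) ∈ σ
    · rw [if_pos hj, Option.some.injEq] at hb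
      have hb' : u j = b := hb
      rwa [← hb']
    · simp [hj] at hb
  · intro hb
    have : u j = b := mem_facet.1 (h hb)
    subst this
    simp [hb]

lemma partialFace_mem_boundaryB {i d : ℕ} (e : Fin (d + 1) → Option Bool) :
    partialFace e ∈ (boundaryB i (d + 1)).faces ↔ e ≠ (fun _ => none) ∧ Low i e ∧ High i e := by
  have hne : (partialFace e).Nonempty ↔ e ≠ (fun _ => none) := by
    have h0 : partialFace (fun _ : Fin (d + 1) => (none : Option Bool)) = ∅ := by
      ext p; simp [mem_partialFace]
    rw [Finset.nonempty_iff_ne_empty, ← h0, partialFace_injective.ne_iff]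
  rw [mem_boundaryB, hne]
  simp only [partialFace_subset_facet, Low, High, and_comm]

/-- Partial words that are both low and high encode the faces together with the empty face. The
latter enters the signed sum with weight `1`, whence the final `+ 1`. -/
lemma eulerChar_boundaryB {d i : ℕ} (hi : i < d) :
    eulerChar (boundaryB i (d + 1)) = (-1) ^ i + (-1) ^ (d - 1 - i) - (-1) ^ d + 1 := by
  classical
  rw [eulerChar_eq_sum]
  have hsum : ∑ σ : Finset (Fin (d + 1) × Bool) with σ ∈ (boundaryB i (d + 1)).faces,
      (-1 : ℤ) ^ σ.card = ∑ e : Fin (d + 1) → Option Bool with e ≠ (fun _ => none) ∧ Low i e ∧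
        High i e, ∏ j, letterSign (e j) := by
    symm
    refine Finset.sum_nbij partialFace (fun e he => ?_) (partialFace_injective.injOn)
      (fun σ hσ => ?_) (fun e _ => prod_letterSign e)
    · simpa [partialFace_mem_boundaryB] using he
    · have hσ' : σ ∈ (boundaryB i (d + 1)).faces := by simpa using hσ
      obtain ⟨-, ⟨u, -, hu⟩, -⟩ := (mem_boundaryB i d σ).1 hσ'
      obtain ⟨e, rfl⟩ := exists_partialFace_eq hu
      exact ⟨e, by simpa [partialFace_mem_boundaryB] using hσ', rfl⟩
  have hnone : Low i (fun _ : Fin (d + 1) => (none : Option Bool)) ∧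
      High i (fun _ : Fin (d + 1) => (none : Option Bool)) := by
    refine ⟨⟨fun _ => true, fun _ _ h => by simp at h, ?_⟩,
      ⟨altWord fun _ => true, fun _ _ h => by simp at h, ?_⟩⟩
    · rw [card_switchSet_const]; omega
    · rw [card_switchSet_altWord_const]; exact hi
  have htot := sum_low_and_high hi
  simp only [mul_ite, mul_one, mul_zero] at htot
  rw [← Finset.sum_filter, ← Finset.add_sum_erase _ _
    (show (fun _ => none) ∈ (univ : Finset (Fin (d + 1) → Option Bool)).filter
      (fun e => Low i e ∧ High i e) by simpa using hnone)] at htot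
  have he : ((univ : Finset (Fin (d + 1) → Option Bool)).filter
      (fun e => Low i e ∧ High i e)).erase (fun _ => none) =
      univ.filter fun e => e ≠ (fun _ => none) ∧ Low i e ∧ High i e := by
    ext e; simp
  rw [he] at htot
  simp only [letterSign, if_true, Finset.prod_const_one] at htot
  rw [hsum]
  simp only [letterSign]
  linarith

end Euler

open Filter Topology

/-! ### Flows and crossing times -/

section Flow

variable {E : Type*} [TopologicalSpace E]

/-- A continuous action of the additive group of the reals. -/
structure IsFlow (φ : ℝ → E → E) : Prop where
  zero : ∀ x, φ 0 x = x
  add : ∀ s t x, φ s (φ t x) = φ (s + t) x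
  cont : Continuous fun p : ℝ × E => φ p.1 p.2

namespace IsFlow

variable {φ : ℝ → E → E} (h : IsFlow φ)
include h

lemma continuous_left (x : E) : Continuous fun t => φ t x :=
  h.cont.comp (continuous_id.prodMk continuous_const)

lemma continuous_right (t : ℝ) : Continuous (φ t) :=
  h.cont.comp (continuous_const.prodMk continuous_id)

lemma neg_self (t : ℝ) (x : E) : φ (-t) (φ t x) = x := by
  rw [h.add, neg_add_cancel, h.zero]

/-- A flow that locally leads from `C` out of `K`, and backwards from `K` out of `C`, does so for
all positive times. -/
lemma notMem_of_local {X C K : Set E} (hX : ∀ t, ∀ x ∈ X, φ t x ∈ X) (hC : IsClosed C)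
    (hCK : C ∪ K = Set.univ)
    (hf : ∀ x ∈ X, x ∈ C → ∀ᶠ t in 𝓝[>] (0 : ℝ), φ t x ∉ K)
    (hb : ∀ x ∈ X, x ∈ K → ∀ᶠ t in 𝓝[>] (0 : ℝ), φ (-t) x ∉ C)
    {x : E} (hx : x ∈ X) (hxC : x ∈ C) {t : ℝ} (ht : 0 < t) : φ t x ∉ K := by
  have hmem : ∀ y, y ∉ K → y ∈ C := fun y hy =>
    ((Set.ext_iff.1 hCK y).2 trivial).resolve_right hy
  -- The times at which the orbit lies in `C` form a closed set. From each of them the orbit leaves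
  -- `K`, hence stays in `C`, for a little longer, so this set contains the whole interval.
  have hall : Set.Icc 0 t ⊆ {s | φ s x ∈ C} := by
    refine IsClosed.Icc_subset_of_forall_exists_gt
      ((hC.preimage (h.continuous_left x)).inter isClosed_Icc)
      (by simpa [h.zero] using hxC) ?_
    rintro s ⟨hs, -⟩ y hy
    have hy' : s < y := hy
    have h1 := hf _ (hX s x hx) hs
    have h2 : ∀ᶠ r in 𝓝[>] (0 : ℝ), r ∈ Set.Ioc 0 (y - s) :=
      Ioc_mem_nhdsGT (by linarith)
    obtain ⟨r, hr1, hr2⟩ := (h1.and h2).exists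
    rw [h.add] at hr1
    exact ⟨r + s, hmem _ hr1, by linarith [hr2.1], by linarith [hr2.2]⟩
  -- If the orbit were in `K` at time `t`, then slightly earlier it would be outside `C`, contrary
  -- to `hall`.
  intro hK
  have h1 := hb _ (hX t x hx) hK
  have h2 : ∀ᶠ r in 𝓝[>] (0 : ℝ), r ∈ Set.Ioc 0 t := Ioc_mem_nhdsGT ht
  obtain ⟨r, hr1, hr2⟩ := (h1.and h2).exists
  rw [h.add] at hr1
  exact hr1 (hall ⟨by linarith [hr2.2], by linarith [hr2.1]⟩)

/-- The time at which an orbit passes from `K` to `C`. -/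
lemma exists_crossing {X C K : Set E} (hX : ∀ t, ∀ x ∈ X, φ t x ∈ X) (hC : IsClosed C)
    (hK : IsClosed K) (hCK : C ∪ K = Set.univ)
    (hpos : ∀ x ∈ X, x ∈ C → ∀ t, 0 < t → φ t x ∉ K)
    (hexK : ∀ x ∈ X, ∃ t, φ t x ∉ K) (hexC : ∀ x ∈ X, ∃ t, φ t x ∉ C) :
    ∃ τ : E → ℝ, ContinuousOn τ X ∧ (∀ x ∈ X, ∀ t, τ (φ t x) = τ x - t) ∧
      ∀ x ∈ X, x ∈ C ∩ K ↔ τ x = 0 := by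
  have hmem : ∀ y, y ∉ K → y ∈ C := fun y hy =>
    ((Set.ext_iff.1 hCK y).2 trivial).resolve_right hy
  have hmem' : ∀ y, y ∉ C → y ∈ K := fun y hy =>
    ((Set.ext_iff.1 hCK y).2 trivial).resolve_left hy
  have hmono : ∀ x ∈ X, ∀ s t, s < t → φ s x ∈ C → φ t x ∉ K := by
    intro x hx s t hst hs
    have := hpos _ (hX s x hx) hs (t - s) (by linarith)
    rwa [h.add, sub_add_cancel] at this
  -- The two closed sets of times cover the line, both are proper, and after a time in `C` there is
  -- none in `K`. So they are complementary closed rays with a common endpoint.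
  have key : ∀ x ∈ X, ∃ τ : ℝ, (∀ t, φ t x ∈ C ↔ τ ≤ t) ∧ ∀ t, φ t x ∈ K ↔ t ≤ τ := by
    intro x hx
    obtain ⟨t0, ht0⟩ := hexC x hx
    obtain ⟨t1, ht1⟩ := hexK x hx
    have hcl : IsClosed {t | φ t x ∈ C} := hC.preimage (h.continuous_left x)
    have hbdd : BddBelow {t | φ t x ∈ C} := ⟨t0, fun s hs => by
      by_contra! hlt
      exact ht0 (hmem _ (hmono x hx s t0 hlt hs))⟩
    have hτ : sInf {t | φ t x ∈ C} ∈ {t | φ t x ∈ C} :=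
      hcl.csInf_mem ⟨t1, hmem _ ht1⟩ hbdd
    have hCiff : ∀ t, φ t x ∈ C ↔ sInf {t | φ t x ∈ C} ≤ t := by
      intro t
      refine ⟨fun ht => csInf_le hbdd ht, fun ht => ?_⟩
      rcases ht.eq_or_lt with he | hlt
      · rw [← he]; exact hτ
      · exact hmem _ (hmono x hx _ t hlt hτ)
    refine ⟨_, hCiff, fun t => ⟨fun ht => ?_, fun ht => ?_⟩⟩
    · by_contra! hlt
      exact hmono x hx _ t hlt hτ ht
    · have hcl' : IsClosed {t | φ t x ∈ K} := hK.preimage (h.continuous_left x)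
      have hsub : Set.Iio (sInf {t | φ t x ∈ C}) ⊆ {t | φ t x ∈ K} := fun s hs =>
        hmem' _ fun hsC => not_le.2 hs ((hCiff s).1 hsC)
      have := hcl'.closure_subset_iff.2 hsub
      rw [closure_Iio] at this
      exact this ht
  choose! τ hτC hτK using key
  refine ⟨τ, ?_, ?_, ?_⟩
  · intro x hx
    -- The inequality `a < τ x` means that `φ a x` is outside `C`, and `τ x < a` that it is outside
    -- `K`. Both are open conditions on `x`.
    rw [ContinuousWithinAt, tendsto_order]
    constructor
    · intro a ha
      have h1 : φ a x ∉ C := fun hc => not_le.2 ha ((hτC x hx a).1 hc)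
      have h2 : ∀ᶠ y in 𝓝[X] x, φ a y ∉ C :=
        ((h.continuous_right a).continuousAt.eventually (hC.isOpen_compl.mem_nhds h1)).filter_mono
          nhdsWithin_le_nhds
      filter_upwards [h2, self_mem_nhdsWithin] with y hy hyX
      exact not_le.1 fun hle => hy ((hτC y hyX a).2 hle)
    · intro a ha
      have h1 : φ a x ∉ K := fun hc => not_le.2 ha ((hτK x hx a).1 hc)
      have h2 : ∀ᶠ y in 𝓝[X] x, φ a y ∉ K :=
        ((h.continuous_right a).continuousAt.eventually (hK.isOpen_compl.mem_nhds h1)).filter_mono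
          nhdsWithin_le_nhds
      filter_upwards [h2, self_mem_nhdsWithin] with y hy hyX
      exact not_le.1 fun hle => hy ((hτK y hyX a).2 hle)
  · intro x hx t
    refine le_antisymm ?_ ?_
    · rw [← hτC _ (hX t x hx), h.add, sub_add_cancel, hτC x hx]
    · rw [← hτK _ (hX t x hx), h.add, sub_add_cancel, hτK x hx]
  · intro x hx
    have h1 := hτC x hx 0
    have h2 := hτK x hx 0
    rw [h.zero] at h1 h2
    rw [Set.mem_inter_iff, h1, h2]
    exact ⟨fun ⟨a, b⟩ => le_antisymm a b, fun e => ⟨e.le, e.ge⟩⟩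

/-- Two transversals of the orbits of a flow together with a dilation action are homeomorphic. -/
lemma nonempty_homeomorph_sections {δ : ℝ → E → E} (hδ : IsFlow δ) {X : Set E}
    (hX : ∀ t, ∀ x ∈ X, φ t x ∈ X) (hXδ : ∀ t, ∀ x ∈ X, δ t x ∈ X) (κ : ℝ → ℝ)
    (hcomm : ∀ t s x, φ t (δ s x) = δ s (φ (κ s * t) x))
    {τ σ : Fin 2 → E → ℝ} (hτ : ∀ k, ContinuousOn (τ k) X) (hσ : ∀ k, ContinuousOn (σ k) X)
    (hτφ : ∀ k, ∀ x ∈ X, ∀ t, τ k (φ t x) = τ k x - t)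
    (hτδ : ∀ k, ∀ x ∈ X, ∀ t, τ k (δ t x) = 0 ↔ τ k x = 0)
    (hσδ : ∀ k, ∀ x ∈ X, ∀ t, σ k (δ t x) = σ k x - t) {S : Fin 2 → Set E}
    (hS : ∀ k x, x ∈ S k ↔ x ∈ X ∧ τ k x = 0 ∧ σ k x = 0) : Nonempty (S 0 ≃ₜ S 1) := by
  -- The retraction to the `k`-th section: first flow to `τ k = 0`, then dilate to `σ k = 0`, which
  -- keeps `τ k = 0`.
  let r : Fin 2 → E → E := fun k x => δ (σ k (φ (τ k x) x)) (φ (τ k x) x)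
  have hrX : ∀ k, ∀ x ∈ X, r k x ∈ X := fun k x hx => hXδ _ _ (hX _ _ hx)
  have hrS : ∀ k, ∀ x ∈ X, r k x ∈ S k := by
    intro k x hx
    have hy := hX (τ k x) x hx
    refine (hS k _).2 ⟨hrX k x hx, ?_, ?_⟩
    · rw [hτδ k _ hy, hτφ k x hx, sub_self]
    · rw [hσδ k _ hy, sub_self]
  have hrc : ∀ k, ContinuousOn (r k) X := by
    intro k
    have h1 : ContinuousOn (fun x => φ (τ k x) x) X :=
      h.cont.comp_continuousOn ((hτ k).prodMk continuousOn_id)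
    have h2 : ContinuousOn (fun x => σ k (φ (τ k x) x)) X :=
      (hσ k).comp h1 fun x hx => hX _ _ hx
    exact hδ.cont.comp_continuousOn (h2.prodMk h1)
  -- `hcomm` writes the point reached by flow, dilation and flow as one flow followed by one
  -- dilation of `x`. Since `τ k` vanishes both at `x` and at that point, the total flow time is
  -- zero; then `σ k` undoes the dilation.
  have hrr : ∀ k l, ∀ x ∈ S k, r k (r l x) = x := by
    intro k l x hxS
    obtain ⟨hx, hx1, hx2⟩ := (hS k x).1 hxS
    set a := τ l x with ha
    set b := σ l (φ a x) with hb
    have hy : r l x = δ b (φ a x) := rfl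
    have hyX := hrX l x hx
    set t := τ k (r l x) with ht
    have h1 : φ t (r l x) = δ b (φ (κ b * t + a) x) := by rw [hy, hcomm, h.add]
    have h2 : τ k (φ t (r l x)) = 0 := by rw [hτφ k _ hyX, ← ht, sub_self]
    rw [h1, hτδ k _ (hX _ _ hx), hτφ k x hx, hx1, zero_sub, neg_eq_zero] at h2
    rw [h2, h.zero] at h1
    change δ (σ k (φ t (r l x))) (φ t (r l x)) = x
    rw [h1, hσδ k x hx, hx2, zero_sub, hδ.neg_self]
  have hSX : ∀ k, ∀ x ∈ S k, x ∈ X := fun k x hx => ((hS k x).1 hx).1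
  refine ⟨⟨⟨fun x => ⟨r 1 x, hrS 1 x (hSX 0 x x.2)⟩, fun x => ⟨r 0 x, hrS 0 x (hSX 1 x x.2)⟩,
    fun x => Subtype.ext (hrr 0 1 x x.2), fun x => Subtype.ext (hrr 1 0 x x.2)⟩, ?_, ?_⟩⟩
  · exact Continuous.subtype_mk ((hrc 1).comp_continuous continuous_subtype_val
      fun x => hSX 0 x x.2) _
  · exact Continuous.subtype_mk ((hrc 0).comp_continuous continuous_subtype_val
      fun x => hSX 1 x x.2) _

end IsFlow

end Flow

/-! ### Linear flows -/

section LinearFlow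

variable {E : Type*} [NormedAddCommGroup E] [NormedSpace ℝ E]

/-- The flow generated by a linear vector field. -/
noncomputable def linFlow (T : E →L[ℝ] E) (t : ℝ) (z : E) : E := NormedSpace.exp (t • T) z

lemma linFlow_smul_generator (T : E →L[ℝ] E) (c t : ℝ) (z : E) :
    linFlow (c • T) t z = linFlow T (c * t) z := by
  rw [linFlow, linFlow, smul_smul, mul_comm]

lemma linFlow_smul (T : E →L[ℝ] E) (t c : ℝ) (x : E) :
    linFlow T t (c • x) = c • linFlow T t x := map_smul _ _ _

variable [CompleteSpace E]

lemma hasSum_linFlow (T : E →L[ℝ] E) (t : ℝ) (z : E) :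
    HasSum (fun n : ℕ => ((n.factorial : ℝ)⁻¹ * t ^ n) • (T ^ n) z) (linFlow T t z) := by
  have h := NormedSpace.exp_series_hasSum_exp' (𝕂 := ℝ) (t • T)
  have h2 := (ContinuousLinearMap.apply ℝ E z).hasSum h
  convert h2 using 1
  · funext n
    rw [ContinuousLinearMap.apply_apply, smul_pow, smul_smul, smul_apply]
  · rfl

lemma hasDerivAt_linFlow (T : E →L[ℝ] E) (z : E) (t : ℝ) :
    HasDerivAt (fun t => linFlow T t z) (linFlow T t (T z)) t := by
  have h := hasDerivAt_exp_smul_const (𝕂 := ℝ) T t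
  exact (ContinuousLinearMap.apply ℝ E z).hasFDerivAt.comp_hasDerivAt t h

lemma isFlow_linFlow (T : E →L[ℝ] E) : IsFlow (linFlow T) := by
  refine ⟨fun x => by simp [linFlow], fun s t x => ?_, ?_⟩
  · let _ : NormedAlgebra ℚ (E →L[ℝ] E) := NormedAlgebra.restrictScalars ℚ ℝ (E →L[ℝ] E)
    rw [linFlow, linFlow, linFlow, add_smul, NormedSpace.exp_add_of_commute]
    · rfl
    · exact ((Commute.refl T).smul_left s).smul_right t
  · have h : Continuous fun t : ℝ => NormedSpace.exp (t • T) :=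
      (differentiable_exp_smul_const ℝ T).continuous
    exact (h.comp continuous_fst).clm_apply continuous_snd

lemma linFlow_semiconj {F : Type*} [NormedAddCommGroup F] [NormedSpace ℝ F] [CompleteSpace F]
    (R : E →L[ℝ] F) (T : E →L[ℝ] E) (T' : F →L[ℝ] F) (h : ∀ z, R (T z) = T' (R z)) (t : ℝ) (z : E) :
    R (linFlow T t z) = linFlow T' t (R z) := by
  have hp : ∀ n : ℕ, ∀ z, R ((T ^ n) z) = (T' ^ n) (R z) := by
    intro n
    induction n with
    | zero => intro z; simp
    | succ n ih => intro z; rw [pow_succ, pow_succ]; exact (ih (T z)).trans (by rw [h]; rfl)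
  have h1 := R.hasSum (hasSum_linFlow T t z)
  have h2 := hasSum_linFlow T' t (R z)
  refine h1.unique ?_
  convert h2 using 1
  funext n
  simp only [map_smul, hp]

lemma linFlow_eigenvector {T : E →L[ℝ] E} {v : E} {c : ℝ} (h : T v = c • v) (t : ℝ) :
    linFlow T t v = Real.exp (t * c) • v := by
  have hp : ∀ n : ℕ, (T ^ n) v = c ^ n • v := by
    intro n
    induction n with
    | zero => simp
    | succ n ih =>
      rw [pow_succ]
      change (T ^ n) (T v) = _
      rw [h, map_smul, ih, smul_smul, pow_succ, mul_comm]
  have h1 := hasSum_linFlow T t v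
  have h2 := (NormedSpace.exp_series_hasSum_exp' (𝕂 := ℝ) (t * c)).smul_const v
  rw [← Real.exp_eq_exp_ℝ] at h2
  refine h1.unique ?_
  convert h2 using 1
  funext n
  rw [hp, smul_smul, smul_eq_mul, mul_pow, mul_assoc]

/-- For small positive times the sign of a functional along an orbit is that of the first
nonvanishing derivative. -/
lemma eventually_pos_linFlow (T : E →L[ℝ] E) (l : E →L[ℝ] ℝ) (n : ℕ) :
    ∀ z, (∀ m < n, l ((T ^ m) z) = 0) → 0 < l ((T ^ n) z) →
      ∀ᶠ t in 𝓝[>] (0 : ℝ), 0 < l (linFlow T t z) := by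
  have hcont : ∀ z, Continuous fun t => l (linFlow T t z) := fun z =>
    l.continuous.comp ((isFlow_linFlow T).continuous_left z)
  induction n with
  | zero =>
    intro z _ hz
    have h0 : l (linFlow T 0 z) = l z := by rw [(isFlow_linFlow T).zero]
    refine ((hcont z).continuousAt.eventually (lt_mem_nhds ?_)).filter_mono nhdsWithin_le_nhds
    simpa [h0] using hz
  | succ n ih =>
    intro z h0 hz
    have hs : ∀ m, (T ^ (m + 1)) z = (T ^ m) (T z) := fun m => by rw [pow_succ]; rfl
    -- The derivative of `l` along the orbit of `z` is `l` along the orbit of `T z`, for which one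
    -- vanishing condition fewer is left.
    have h1 := ih (T z) (fun m hm => by rw [← hs]; exact h0 (m + 1) (by omega)) (by rwa [← hs])
    obtain ⟨ε, hε, hsub⟩ := mem_nhdsGT_iff_exists_Ioo_subset.1 h1
    have hε' : (0 : ℝ) < ε := hε
    have hder : ∀ t, HasDerivAt (fun t => l (linFlow T t z)) (l (linFlow T t (T z))) t := fun t =>
      l.hasFDerivAt.comp_hasDerivAt t (hasDerivAt_linFlow T z t)
    have hmono : StrictMonoOn (fun t => l (linFlow T t z)) (Set.Ico 0 ε) := by
      refine strictMonoOn_of_deriv_pos (convex_Ico 0 ε) (hcont z).continuousOn fun t ht => ?_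
      rw [interior_Ico] at ht
      rw [(hder t).deriv]
      exact hsub ht
    filter_upwards [Ioo_mem_nhdsGT hε'] with t ht
    have h2 := hmono ⟨le_rfl, hε'⟩ ⟨ht.1.le, ht.2⟩ ht.1
    have h3 : l (linFlow T 0 z) = 0 := by
      rw [(isFlow_linFlow T).zero]
      simpa using h0 0 (by omega)
    simpa [h3] using h2

end LinearFlow

/-! ### Sign variation of real vectors -/

section Variation

variable {d : ℕ}

/-- The word `u` is compatible with the signs of `z`, with `true` for `+` and `false` for `-`. -/
def Compat (u : Fin d → Bool) (z : Fin d → ℝ) : Prop :=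
  ∀ j, (u j = true → 0 ≤ z j) ∧ (u j = false → z j ≤ 0)

/-- The vectors with at most `i` sign changes, zeros being counted in the most favourable way. -/
def lowVar (d i : ℕ) : Set (Fin d → ℝ) := {z | ∃ u, Compat u z ∧ (switchSet u).card ≤ i}

/-- The vectors with more than `i` sign changes, zeros being counted in the most favourable way. -/
def highVar (d i : ℕ) : Set (Fin d → ℝ) := {z | ∃ u, Compat u z ∧ i < (switchSet u).card}

lemma isClosed_compat (u : Fin d → Bool) : IsClosed {z | Compat u z} := by
  simp only [Compat, Set.ofPred_forall, Set.ofPred_and]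
  refine isClosed_iInter fun j => IsClosed.inter ?_ ?_
  · exact isClosed_iInter fun _ => isClosed_le continuous_const (continuous_apply j)
  · exact isClosed_iInter fun _ => isClosed_le (continuous_apply j) continuous_const

lemma isClosed_lowVar (i : ℕ) : IsClosed (lowVar d i) := by
  have : lowVar d i = ⋃ u ∈ {u : Fin d → Bool | (switchSet u).card ≤ i}, {z | Compat u z} := by
    ext z; simp [lowVar, and_comm]
  rw [this]
  exact (Set.toFinite _).isClosed_biUnion fun u _ => isClosed_compat u

lemma isClosed_highVar (i : ℕ) : IsClosed (highVar d i) := by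
  have : highVar d i = ⋃ u ∈ {u : Fin d → Bool | i < (switchSet u).card}, {z | Compat u z} := by
    ext z; simp [highVar, and_comm]
  rw [this]
  exact (Set.toFinite _).isClosed_biUnion fun u _ => isClosed_compat u

lemma exists_compat (z : Fin d → ℝ) : ∃ u, Compat u z := by
  refine ⟨fun j => decide (0 ≤ z j), fun j => ⟨fun h => by simpa using h, fun h => ?_⟩⟩
  have : z j < 0 := by simpa using h
  exact this.le

lemma lowVar_union_highVar (i : ℕ) : lowVar d i ∪ highVar d i = Set.univ := by
  refine Set.eq_univ_of_forall fun z => ?_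
  obtain ⟨u, hu⟩ := exists_compat z
  rcases le_or_gt (switchSet u).card i with h | h
  · exact Or.inl ⟨u, hu, h⟩
  · exact Or.inr ⟨u, hu, h⟩

lemma compat_congr {u : Fin d → Bool} {z w : Fin d → ℝ} (c : Fin d → ℝ) (hc : ∀ j, 0 < c j)
    (h : ∀ j, w j = c j * z j) : Compat u w ↔ Compat u z := by
  refine forall_congr' fun j => ?_
  have h1 : 0 ≤ w j ↔ 0 ≤ z j := by rw [h, mul_nonneg_iff_of_pos_left (hc j)]
  have h2 : w j ≤ 0 ↔ z j ≤ 0 := by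
    rw [h, ← not_lt, ← not_lt, mul_pos_iff_of_pos_left (hc j)]
  rw [h1, h2]

lemma mem_lowVar_congr {z w : Fin d → ℝ} (c : Fin d → ℝ) (hc : ∀ j, 0 < c j)
    (h : ∀ j, w j = c j * z j) {i : ℕ} : w ∈ lowVar d i ↔ z ∈ lowVar d i := by
  simp only [lowVar, Set.mem_ofPred_eq, compat_congr c hc h]

lemma mem_highVar_congr {z w : Fin d → ℝ} (c : Fin d → ℝ) (hc : ∀ j, 0 < c j)
    (h : ∀ j, w j = c j * z j) {i : ℕ} : w ∈ highVar d i ↔ z ∈ highVar d i := by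
  simp only [highVar, Set.mem_ofPred_eq, compat_congr c hc h]

lemma Compat.neg {u : Fin d → Bool} {z : Fin d → ℝ} (h : Compat u z) :
    Compat (fun j => !u j) (-z) := by
  intro j
  have := h j
  cases hj : u j <;> simp_all

lemma neg_mem_lowVar {z : Fin d → ℝ} {i : ℕ} (h : z ∈ lowVar d i) : -z ∈ lowVar d i := by
  obtain ⟨u, hu, hi⟩ := h
  exact ⟨_, hu.neg, by rwa [card_switchSet_not]⟩

lemma neg_mem_highVar {z : Fin d → ℝ} {i : ℕ} (h : z ∈ highVar d i) : -z ∈ highVar d i := by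
  obtain ⟨u, hu, hi⟩ := h
  exact ⟨_, hu.neg, by rwa [card_switchSet_not]⟩

lemma smul_mem_lowVar {z : Fin d → ℝ} {i : ℕ} {c : ℝ} (hc : c ≠ 0) :
    c • z ∈ lowVar d i ↔ z ∈ lowVar d i := by
  rcases hc.lt_or_gt with h | h
  · rw [← mem_lowVar_congr (z := z) (w := -(c • z)) (fun _ => -c) (fun _ => by linarith) (by simp)]
    exact ⟨fun h => neg_mem_lowVar h, fun h => by simpa using neg_mem_lowVar h⟩
  · exact mem_lowVar_congr (fun _ => c) (fun _ => h) (by simp)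

lemma smul_mem_highVar {z : Fin d → ℝ} {i : ℕ} {c : ℝ} (hc : c ≠ 0) :
    c • z ∈ highVar d i ↔ z ∈ highVar d i := by
  rcases hc.lt_or_gt with h | h
  · rw [← mem_highVar_congr (z := z) (w := -(c • z)) (fun _ => -c) (fun _ => by linarith) (by simp)]
    exact ⟨fun h => neg_mem_highVar h, fun h => by simpa using neg_mem_highVar h⟩
  · exact mem_highVar_congr (fun _ => c) (fun _ => h) (by simp)

/-- Changing the signs of alternate coordinates. -/
noncomputable def altMap (d : ℕ) : (Fin d → ℝ) →L[ℝ] (Fin d → ℝ) :=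
  ContinuousLinearMap.pi fun j =>
    (if (j : ℕ) % 2 = 1 then (-1 : ℝ) else 1) • ContinuousLinearMap.proj j

lemma altMap_apply (z : Fin d → ℝ) (j : Fin d) :
    altMap d z j = if (j : ℕ) % 2 = 1 then -z j else z j := by
  simp only [altMap, ContinuousLinearMap.coe_pi', smul_apply,
    ContinuousLinearMap.proj_apply, smul_eq_mul]
  split_ifs <;> ring

lemma altMap_altMap (z : Fin d → ℝ) : altMap d (altMap d z) = z := by
  funext j
  simp only [altMap_apply]
  split_ifs <;> simp

lemma Compat.alt {u : Fin d → Bool} {z : Fin d → ℝ} (h : Compat u z) :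
    Compat (altWord u) (altMap d z) := by
  intro j
  have := h j
  rw [altMap_apply, altWord]
  by_cases hj : (j : ℕ) % 2 = 1 <;> cases hu : u j <;> simp_all

lemma altMap_mem_lowVar {i : ℕ} (hi : i < d) {z : Fin (d + 1) → ℝ} (h : z ∈ highVar (d + 1) i) :
    altMap (d + 1) z ∈ lowVar (d + 1) (d - 1 - i) := by
  obtain ⟨u, hu, h⟩ := h
  have := card_switchSet_altWord u
  exact ⟨_, hu.alt, by omega⟩

lemma altMap_mem_highVar {i : ℕ} (hi : i < d) {z : Fin (d + 1) → ℝ} (h : z ∈ lowVar (d + 1) i) :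
    altMap (d + 1) z ∈ highVar (d + 1) (d - 1 - i) := by
  obtain ⟨u, hu, h⟩ := h
  have := card_switchSet_altWord u
  exact ⟨_, hu.alt, by omega⟩

/-- For small positive times the flow of `T` does not increase the sign variation of `z`. -/
def Diminishes (T : (Fin d → ℝ) →L[ℝ] (Fin d → ℝ)) (z : Fin d → ℝ) : Prop :=
  ∀ u, Compat u z → ∀ᶠ t in 𝓝[>] (0 : ℝ), ∀ v, Compat v (linFlow T t z) →
    (switchSet v).card ≤ (switchSet u).card

/-- A criterion for `Diminishes`: the sign taken by each coordinate at small times is the sign of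
some nonzero coordinate of `z`, at a place that depends monotonically on the coordinate. -/
lemma diminishes_of_rel {T : (Fin d → ℝ) →L[ℝ] (Fin d → ℝ)} {z : Fin d → ℝ}
    (R : Fin d → Fin d → Prop) (hR : ∀ j j' k k', j < j' → R j k → R j' k' → k ≤ k')
    (h : ∀ j, (∃ k n, R j k ∧ 0 < z k ∧ (∀ m < n, (T ^ m) z j = 0) ∧ 0 < (T ^ n) z j) ∨
      (∃ k n, R j k ∧ z k < 0 ∧ (∀ m < n, (T ^ m) z j = 0) ∧ (T ^ n) z j < 0) ∨
      (∃ k k', R j k ∧ R j k' ∧ 0 < z k ∧ z k' < 0)) : Diminishes T z := by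
  intro u hu
  have hpos : ∀ k, 0 < z k → u k = true := fun k hk => by
    by_contra hne
    exact not_le.2 hk ((hu k).2 (by simpa using hne))
  have hneg : ∀ k, z k < 0 → u k = false := fun k hk => by
    by_contra hne
    exact not_le.2 hk ((hu k).1 (by simpa using hne))
  have key : ∀ j, ∀ᶠ t in 𝓝[>] (0 : ℝ), ∀ v, Compat v (linFlow T t z) →
      ∃ k, R j k ∧ v j = u k := by
    intro j
    rcases h j with ⟨k, n, hk, hzk, h0, hn⟩ | ⟨k, n, hk, hzk, h0, hn⟩ | ⟨k, k', hk, hk', hzk, hzk'⟩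
    · filter_upwards [eventually_pos_linFlow T (ContinuousLinearMap.proj j) n z h0 hn] with t ht v hv
      refine ⟨k, hk, ?_⟩
      rw [hpos k hzk]
      by_contra hne
      exact not_le.2 ht ((hv j).2 (by simpa using hne))
    · filter_upwards [eventually_pos_linFlow T (-ContinuousLinearMap.proj j) n z
        (fun m hm => by simpa using h0 m hm) (by simpa using hn)] with t ht v hv
      refine ⟨k, hk, ?_⟩
      rw [hneg k hzk]
      by_contra hne
      have h1 := (hv j).1 (by simpa using hne)
      have h2 : 0 < -(linFlow T t z j) := ht
      linarith
    -- Here both signs occur at places admitted by `R`, so the sign taken by coordinate `j` does not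
    -- matter.
    · refine Eventually.of_forall fun t v _ => ?_
      cases hvj : v j
      · exact ⟨k', hk', (hneg k' hzk').symm⟩
      · exact ⟨k, hk, (hpos k hzk).symm⟩
  filter_upwards [eventually_all.2 key] with t ht v hv
  exact card_switchSet_le_of_rel u v R hR fun j => ht j v hv

/-- A variation diminishing flow that is reversed by `altMap` leads from `lowVar` out of
`highVar`. -/
lemma linFlow_notMem_highVar {T : (Fin (d + 1) → ℝ) →L[ℝ] (Fin (d + 1) → ℝ)}
    (hT : ∀ z, altMap (d + 1) (T z) = -T (altMap (d + 1) z)) {X : Set (Fin (d + 1) → ℝ)}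
    (hX : ∀ t, ∀ z ∈ X, linFlow T t z ∈ X) (hd : ∀ z ∈ X, Diminishes T z)
    (hd' : ∀ z ∈ X, Diminishes T (altMap (d + 1) z)) {i : ℕ} (hi : i < d)
    {z : Fin (d + 1) → ℝ} (hz : z ∈ X) (hl : z ∈ lowVar (d + 1) i) {t : ℝ} (ht : 0 < t) :
    linFlow T t z ∉ highVar (d + 1) i := by
  have hforward : ∀ z i, Diminishes T z → z ∈ lowVar (d + 1) i →
      ∀ᶠ t in 𝓝[>] (0 : ℝ), linFlow T t z ∉ highVar (d + 1) i := by
    rintro z i hz ⟨u, hu, hi⟩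
    filter_upwards [hz u hu] with t ht
    rintro ⟨v, hv, hvi⟩
    have := ht v hv
    omega
  refine (isFlow_linFlow T).notMem_of_local hX (isClosed_lowVar i) (lowVar_union_highVar i)
    (fun z hz hl => hforward z i (hd z hz) hl) (fun z hz hh => ?_) hz hl ht
  -- `altMap` conjugates the backward flow to the forward one and exchanges `lowVar` and `highVar`,
  -- with `d - 1 - i` in place of `i`. The backward statement is thus the forward one for `altMap
  -- z`.
  filter_upwards [hforward _ _ (hd' z hz) (altMap_mem_lowVar hi hh)] with t ht hl
  have h1 := linFlow_semiconj (altMap (d + 1)) (-T) T (fun z => by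
    rw [neg_apply, map_neg, hT, neg_neg]) t z
  have h2 : linFlow (-T) t z = linFlow T (-t) z := by
    rw [linFlow, linFlow, smul_neg, neg_smul]
  rw [h2] at h1
  rw [← h1] at ht
  exact ht (altMap_mem_highVar hi hl)

end Variation

/-! ### The adjacency operator of a path -/

section Path

variable {d : ℕ}

/-- The adjacency operator of a path with `d` vertices. -/
noncomputable def pathOp (d : ℕ) : (Fin d → ℝ) →L[ℝ] (Fin d → ℝ) :=
  ContinuousLinearMap.pi fun j => ∑ k : Fin d,
    (if ((j : ℤ) - k).natAbs = 1 then (1 : ℝ) else 0) • ContinuousLinearMap.proj k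

lemma pathOp_apply (z : Fin d → ℝ) (j : Fin d) :
    pathOp d z j = ∑ k : Fin d, if ((j : ℤ) - k).natAbs = 1 then z k else 0 := by
  simp only [pathOp, ContinuousLinearMap.coe_pi', sum_apply, smul_apply,
    ContinuousLinearMap.proj_apply, smul_eq_mul, ite_mul, one_mul, zero_mul]

lemma altMap_pathOp (z : Fin d → ℝ) : altMap d (pathOp d z) = -pathOp d (altMap d z) := by
  funext j
  rw [altMap_apply, Pi.neg_apply, pathOp_apply, pathOp_apply]
  split_ifs with hj
  · congr 1
    refine Finset.sum_congr rfl fun k _ => ?_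
    split_ifs with h
    · rw [altMap_apply, if_neg (by omega)]
    · rfl
  · rw [← Finset.sum_neg_distrib]
    refine Finset.sum_congr rfl fun k _ => ?_
    split_ifs with h
    · rw [altMap_apply, if_pos (by omega), neg_neg]
    · simp

lemma pathOp_pow_eq_zero (m : ℕ) : ∀ (n : ℕ) (z : Fin d → ℝ) (j : Fin d),
    (∀ k : Fin d, ((j : ℤ) - k).natAbs < n → z k = 0) → m < n → (pathOp d ^ m) z j = 0 := by
  induction m with
  | zero =>
    intro n z j h hn
    simpa using h j (by simpa using hn)
  | succ m ih =>
    intro n z j h hn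
    rw [pow_succ]
    refine ih (n - 1) (pathOp d z) j (fun k hk => ?_) (by omega)
    rw [pathOp_apply]
    refine Finset.sum_eq_zero fun l _ => ?_
    split_ifs with hl
    · exact h l (by omega)
    · rfl

/-- The entry of the `n`-th power at `(j, k)` counts walks of length `n`. None exists beyond
distance `n`, and closer coordinates vanish by hypothesis, so only nonnegative entries at distance
exactly `n` contribute. -/
lemma pathOp_pow_pos (n : ℕ) : ∀ (z : Fin d → ℝ) (j : Fin d),
    (∀ k : Fin d, ((j : ℤ) - k).natAbs < n → z k = 0) →
    (∀ k : Fin d, ((j : ℤ) - k).natAbs = n → 0 ≤ z k) →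
    (∃ k : Fin d, ((j : ℤ) - k).natAbs = n ∧ 0 < z k) → 0 < (pathOp d ^ n) z j := by
  induction n with
  | zero =>
    rintro z j - - ⟨k, hk, hz⟩
    have : j = k := Fin.ext (by omega)
    simpa [this] using hz
  | succ n ih =>
    rintro z j h0 h1 ⟨k, hk, hz⟩
    rw [pow_succ]
    have hnn : ∀ l : Fin d, ((j : ℤ) - l).natAbs = n → ∀ p ∈ Finset.univ,
        0 ≤ if ((l : ℤ) - (p : Fin d)).natAbs = 1 then z p else 0 := by
      intro l hl p _
      split_ifs with hp
      · rcases Nat.lt_or_ge ((j : ℤ) - p).natAbs (n + 1) with h | h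
        · rw [h0 p h]
        · exact h1 p (by omega)
      · exact le_rfl
    refine ih (pathOp d z) j (fun l hl => ?_) (fun l hl => ?_) ?_
    · rw [pathOp_apply]
      refine Finset.sum_eq_zero fun p _ => ?_
      split_ifs with hp
      · exact h0 p (by omega)
      · rfl
    · rw [pathOp_apply]
      exact Finset.sum_nonneg (hnn l hl)
    · obtain ⟨l, hl, hlk⟩ : ∃ l : Fin d, ((j : ℤ) - l).natAbs = n ∧ ((l : ℤ) - k).natAbs = 1 := by
        rcases Nat.lt_or_ge (j : ℕ) k with h | h
        · exact ⟨⟨k - 1, by omega⟩, by simp only []; omega, by simp only []; omega⟩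
        · exact ⟨⟨k + 1, by omega⟩, by simp only []; omega, by simp only []; omega⟩
      refine ⟨l, hl, ?_⟩
      rw [pathOp_apply]
      refine lt_of_lt_of_le ?_ (Finset.single_le_sum (hnn l hl) (Finset.mem_univ k))
      rwa [if_pos hlk]

/-- At small times coordinate `j` takes the sign of the nonzero coordinate of `z` nearest to it, and
nearest places depend monotonically on `j`. If two nearest ones have opposite signs, either sign is
harmless. -/
lemma diminishes_pathOp {z : Fin d → ℝ} (hz : z ≠ 0) : Diminishes (pathOp d) z := by
  refine diminishes_of_rel
    (fun j k => z k ≠ 0 ∧ ∀ l, z l ≠ 0 → ((j : ℤ) - k).natAbs ≤ ((j : ℤ) - l).natAbs) ?_ ?_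
  · rintro j j' k k' hj ⟨hk, h1⟩ ⟨hk', h2⟩
    have h3 := h1 k' hk'
    have h4 := h2 k hk
    have h5 : (j : ℕ) < j' := hj
    rw [Fin.le_def]
    omega
  · intro j
    classical
    obtain ⟨k₁, hk₁⟩ := Function.ne_iff.1 hz
    have hex : ∃ n, ∃ k, z k ≠ 0 ∧ ((j : ℤ) - k).natAbs = n := ⟨_, k₁, hk₁, rfl⟩
    obtain ⟨k₀, hk₀, hn⟩ := Nat.find_spec hex
    set n := Nat.find hex with hndef
    have hmin : ∀ l, z l ≠ 0 → n ≤ ((j : ℤ) - l).natAbs := fun l hl =>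
      Nat.find_min' hex ⟨l, hl, rfl⟩
    have hlt : ∀ l : Fin d, ((j : ℤ) - l).natAbs < n → z l = 0 := fun l hl => by
      by_contra hne
      exact not_le.2 hl (hmin l hne)
    have hR : ∀ k : Fin d, z k ≠ 0 → ((j : ℤ) - k).natAbs = n →
        z k ≠ 0 ∧ ∀ l, z l ≠ 0 → ((j : ℤ) - k).natAbs ≤ ((j : ℤ) - l).natAbs :=
      fun k hk hkn => ⟨hk, fun l hl => hkn ▸ hmin l hl⟩
    by_cases hp : ∃ k : Fin d, ((j : ℤ) - k).natAbs = n ∧ 0 < z k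
    · by_cases hq : ∃ k : Fin d, ((j : ℤ) - k).natAbs = n ∧ z k < 0
      · obtain ⟨k, hk, hzk⟩ := hp
        obtain ⟨k', hk', hzk'⟩ := hq
        exact Or.inr (Or.inr ⟨k, k', hR k hzk.ne' hk, hR k' hzk'.ne hk', hzk, hzk'⟩)
      · push Not at hq
        obtain ⟨k, hk, hzk⟩ := hp
        exact Or.inl ⟨k, n, hR k hzk.ne' hk, hzk, fun m hm => pathOp_pow_eq_zero m n z j hlt hm,
          pathOp_pow_pos n z j hlt hq ⟨k, hk, hzk⟩⟩
    · push Not at hp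
      have hzk : z k₀ < 0 := lt_of_le_of_ne (hp k₀ hn) hk₀
      refine Or.inr (Or.inl ⟨k₀, n, hR k₀ hk₀ hn, hzk,
        fun m hm => pathOp_pow_eq_zero m n z j hlt hm, ?_⟩)
      have := pathOp_pow_pos n (-z) j (fun k hk => by simp [hlt k hk])
        (fun k hk => by simpa using hp k hk) ⟨k₀, hn, by simpa using hzk⟩
      simpa using this

lemma linFlow_ne_zero {E : Type*} [NormedAddCommGroup E] [NormedSpace ℝ E] [CompleteSpace E]
    (T : E →L[ℝ] E) (t : ℝ) {z : E} (hz : z ≠ 0) : linFlow T t z ≠ 0 := by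
  intro h
  have h1 := (isFlow_linFlow T).neg_self t z
  rw [h, linFlow, map_zero] at h1
  exact hz h1.symm

lemma highVar_eq_empty {i : ℕ} (hi : d ≤ i) : highVar (d + 1) i = ∅ := by
  refine Set.eq_empty_of_forall_notMem ?_
  rintro z ⟨u, -, h⟩
  have := card_switchSet_le u
  omega

lemma linFlow_pathOp_notMem_highVar {i : ℕ} {z : Fin (d + 1) → ℝ} (hz : z ≠ 0)
    (hl : z ∈ lowVar (d + 1) i) {t : ℝ} (ht : 0 < t) :
    linFlow (pathOp (d + 1)) t z ∉ highVar (d + 1) i := by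
  rcases Nat.lt_or_ge i d with hi | hi
  · refine linFlow_notMem_highVar altMap_pathOp (X := {z | z ≠ 0})
      (fun t z hz => linFlow_ne_zero _ t hz) (fun z hz => diminishes_pathOp hz)
      (fun z hz => diminishes_pathOp fun h => hz ?_) hi hz hl ht
    rw [← altMap_altMap z, h, map_zero]
  · simp [highVar_eq_empty hi]

lemma mem_lowVar_of_notMem_highVar {i : ℕ} {z : Fin d → ℝ} (h : z ∉ highVar d i) :
    z ∈ lowVar d i :=
  ((Set.ext_iff.1 (lowVar_union_highVar i) z).2 trivial).resolve_right h

lemma mem_highVar_of_notMem_lowVar {i : ℕ} {z : Fin d → ℝ} (h : z ∉ lowVar d i) :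
    z ∈ highVar d i :=
  ((Set.ext_iff.1 (lowVar_union_highVar i) z).2 trivial).resolve_left h

/-- A vector whose first coordinate vanishes has different extreme sign variations. -/
lemma mem_lowVar_pred {s : ℕ} {z : Fin (d + 2) → ℝ} (h0 : z 0 = 0) (h : z ∉ highVar (d + 2) s) :
    1 ≤ s ∧ z ∈ lowVar (d + 2) (s - 1) := by
  obtain ⟨u, hu⟩ := exists_compat z
  set w : Fin (d + 1) → Bool := Fin.tail u with hw
  have hc : ∀ b, Compat (Fin.cons b w : Fin (d + 2) → Bool) z := by
    intro b j
    refine Fin.cases ?_ (fun k => ?_) j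
    · simp [h0]
    · rw [Fin.cons_succ]; exact hu k.succ
  have h1 : (switchSet (Fin.cons (!w 0) w : Fin (d + 2) → Bool)).card ≤ s := by
    by_contra! hlt
    exact h ⟨_, hc _, hlt⟩
  rw [card_switchSet_cons, if_neg (by simp)] at h1
  refine ⟨by omega, _, hc (w 0), ?_⟩
  rw [card_switchSet_cons, if_pos rfl]
  omega

end Path

/-! ### The eigenbasis of the path -/

section Eigenbasis

variable {d : ℕ}

lemma exists_basis_pathOp (d : ℕ) : ∃ (b : Module.Basis (Fin d) ℝ (Fin d → ℝ)) (c : Fin d → ℝ),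
    ∀ k, pathOp d (b k) = c k • b k := by
  let A : Matrix (Fin d) (Fin d) ℝ := fun j k => if ((j : ℤ) - k).natAbs = 1 then 1 else 0
  have hA : A.IsHermitian := by
    ext j k
    have h : ((k : ℤ) - j).natAbs = ((j : ℤ) - k).natAbs := by omega
    rw [Matrix.conjTranspose_apply, star_trivial]
    simp only [A, h]
  refine ⟨hA.eigenvectorBasis.toBasis.map (WithLp.linearEquiv 2 ℝ (Fin d → ℝ)), hA.eigenvalues,
    fun k => ?_⟩
  have h := hA.mulVec_eigenvectorBasis k
  have hT : ∀ z, pathOp d z = A.mulVec z := by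
    intro z; funext j
    rw [pathOp_apply, Matrix.mulVec, dotProduct]
    exact Finset.sum_congr rfl fun k _ => by simp [A]
  rw [hT]
  simpa using h

variable {ι E : Type*} [Fintype ι] [NormedAddCommGroup E] [NormedSpace ℝ E]
  [CompleteSpace E] {T : E →L[ℝ] E} {b : Module.Basis ι ℝ E} {c : ι → ℝ}

lemma linFlow_eq_sum (hb : ∀ k, T (b k) = c k • b k) (t : ℝ) (z : E) :
    linFlow T t z = ∑ k, (Real.exp (t * c k) * b.repr z k) • b k := by
  conv_lhs => rw [← b.sum_repr z, linFlow, map_sum]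
  refine Finset.sum_congr rfl fun k _ => ?_
  rw [map_smul, ← linFlow, linFlow_eigenvector (hb k), smul_smul, mul_comm]

lemma repr_linFlow (hb : ∀ k, T (b k) = c k • b k) (t : ℝ) (z : E) (k : ι) :
    b.repr (linFlow T t z) k = Real.exp (t * c k) * b.repr z k := by
  rw [linFlow_eq_sum hb, b.repr_sum_self]

/-- Along a filter on which one eigenvector dominates, orbits become parallel to it. -/
lemma eventually_linFlow_notMem (hb : ∀ k, T (b k) = c k • b k) {z : E} {k : ι}
    (hk : b.repr z k ≠ 0) {F : Filter ℝ}
    (hF : ∀ l ≠ k, b.repr z l ≠ 0 → Tendsto (fun t => t * (c l - c k)) F atBot)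
    {K : Set E} (hK : IsClosed K) (hKs : ∀ (a : ℝ) (x : E), a ≠ 0 → (a • x ∈ K ↔ x ∈ K))
    (hbk : b k ∉ K) : ∀ᶠ t in F, linFlow T t z ∉ K := by
  classical
  -- After division by the growth of the dominant component all other components tend to zero.
  -- Membership in `K` ignores this rescaling.
  have hlim : Tendsto (fun t => Real.exp (-(t * c k)) • linFlow T t z) F
      (𝓝 (b.repr z k • b k)) := by
    have h1 : ∀ t, Real.exp (-(t * c k)) • linFlow T t z =
        ∑ l, (Real.exp (t * (c l - c k)) * b.repr z l) • b l := by
      intro t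
      rw [linFlow_eq_sum hb, Finset.smul_sum]
      refine Finset.sum_congr rfl fun l _ => ?_
      rw [smul_smul, ← mul_assoc, ← Real.exp_add]
      congr 3
      ring
    have h2 : b.repr z k • b k = ∑ l, if l = k then b.repr z k • b k else 0 := by simp
    simp only [h1]
    rw [h2]
    refine tendsto_finsetSum _ fun l _ => ?_
    split_ifs with hl
    · subst hl; simpa using tendsto_const_nhds
    · by_cases hz : b.repr z l = 0
      · simpa [hz] using tendsto_const_nhds
      · have := ((Real.tendsto_exp_atBot.comp (hF l hl hz)).mul_const (b.repr z l)).smul_const (b l)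
        simpa using this
  have h3 : b.repr z k • b k ∉ K := by rwa [hKs _ _ hk]
  filter_upwards [hlim.eventually (hK.isOpen_compl.mem_nhds h3)] with t ht
  intro h
  exact ht ((hKs _ _ (Real.exp_ne_zero _)).2 h)

/-- A discrete Sturm oscillation theorem, obtained from variation diminution alone. The line of an
eigenvector is invariant under the flow, so its variation is unambiguous. Variations strictly
increase as eigenvalues decrease, and only `d + 2` values are available, so each occurs once. -/
theorem exists_eigenbasis (d : ℕ) :
    ∃ (b : Module.Basis (Fin (d + 2)) ℝ (Fin (d + 2) → ℝ)) (c : Fin (d + 2) → ℝ),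
      StrictAnti c ∧ (∀ k, pathOp (d + 2) (b k) = c k • b k) ∧
      ∀ k i, (b k ∈ lowVar (d + 2) i ↔ (k : ℕ) ≤ i) ∧ (b k ∈ highVar (d + 2) i ↔ i < (k : ℕ)) := by
  classical
  obtain ⟨b, c, hb⟩ := exists_basis_pathOp (d + 2)
  have hdim : ∀ v : Fin (d + 2) → ℝ, v ∈ lowVar (d + 2) (d + 1) := fun v =>
    mem_lowVar_of_notMem_highVar (by simp [highVar_eq_empty])
  have hex : ∀ v : Fin (d + 2) → ℝ, ∃ s, v ∈ lowVar (d + 2) s := fun v => ⟨_, hdim v⟩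
  have hmonoLow : ∀ {v : Fin (d + 2) → ℝ} {i j : ℕ}, i ≤ j → v ∈ lowVar (d + 2) i →
      v ∈ lowVar (d + 2) j := by
    rintro v i j hij ⟨u, hu, hi⟩
    exact ⟨u, hu, hi.trans hij⟩
  have heig : ∀ (v : Fin (d + 2) → ℝ) (a : ℝ), v ≠ 0 → pathOp (d + 2) v = a • v → ∀ i,
      v ∈ lowVar (d + 2) i → v ∉ highVar (d + 2) i := by
    intro v a hv hva i hi hh
    have h1 := linFlow_pathOp_notMem_highVar hv hi one_pos
    rw [linFlow_eigenvector hva, smul_mem_highVar (Real.exp_ne_zero _)] at h1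
    exact h1 hh
  -- A zero first coordinate would allow one switch fewer than the minimum. Applied to the
  -- combination `w k l`, whose first coordinate is zero, this also shows that the eigenvalues are
  -- simple.
  have hfirst : ∀ (v : Fin (d + 2) → ℝ) (a : ℝ), v ≠ 0 → pathOp (d + 2) v = a • v → v 0 ≠ 0 := by
    intro v a hv hva h0
    obtain ⟨h1, h2⟩ := mem_lowVar_pred h0 (heig v a hv hva _ (Nat.find_spec (hex v)))
    have := Nat.find_min' (hex v) h2
    omega
  have hb0 : ∀ k, b k 0 ≠ 0 := fun k => hfirst _ _ (b.ne_zero k) (hb k)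
  let w : Fin (d + 2) → Fin (d + 2) → Fin (d + 2) → ℝ := fun k l => b l 0 • b k - b k 0 • b l
  have hw0 : ∀ k l, w k l 0 = 0 := fun k l => by simp [w, mul_comm]
  have hwr : ∀ k l m, b.repr (w k l) m =
      b l 0 * (if k = m then 1 else 0) - b k 0 * (if l = m then 1 else 0) := by
    intro k l m
    simp [w, Module.Basis.repr_self, Finsupp.single_apply]
  have hwk : ∀ k l, k ≠ l → b.repr (w k l) k ≠ 0 := fun k l hkl => by
    rw [hwr, if_pos rfl, if_neg hkl.symm]; simpa using hb0 l
  have hwl : ∀ k l, k ≠ l → b.repr (w k l) l ≠ 0 := fun k l hkl => by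
    rw [hwr, if_pos rfl, if_neg hkl]; simpa using hb0 k
  have hwm : ∀ k l m, b.repr (w k l) m ≠ 0 → m = k ∨ m = l := by
    intro k l m h
    by_contra! hne
    rw [hwr, if_neg hne.1.symm, if_neg hne.2.symm] at h
    simp at h
  have hwne : ∀ k l, k ≠ l → w k l ≠ 0 := fun k l hkl h => by
    have := hwk k l hkl
    simp [h] at this
  have hinj : Function.Injective c := by
    intro k l hc
    by_contra hkl
    refine hfirst (w k l) (c k) (hwne k l hkl) ?_ (hw0 k l)
    simp only [w, map_sub, map_smul, hb, hc]
    rw [smul_sub, smul_comm, smul_comm (c l) (b k 0)]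
  let s : Fin (d + 2) → ℕ := fun k => Nat.find (hex (b k))
  have hslow : ∀ k i, b k ∈ lowVar (d + 2) i ↔ s k ≤ i := fun k i =>
    ⟨fun h => Nat.find_min' _ h, fun h => hmonoLow h (Nat.find_spec (hex (b k)))⟩
  have hshigh : ∀ k i, b k ∈ highVar (d + 2) i ↔ i < s k := by
    intro k i
    constructor
    · intro h
      by_contra! hle
      exact heig _ _ (b.ne_zero k) (hb k) i ((hslow k i).2 hle) h
    · intro h
      exact mem_highVar_of_notMem_lowVar fun hl => not_le.2 h ((hslow k i).1 hl)
  have hscale : ∀ i (a : ℝ) (x : Fin (d + 2) → ℝ), a ≠ 0 →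
      (a • x ∈ highVar (d + 2) i ↔ x ∈ highVar (d + 2) i) := fun i a x ha => smul_mem_highVar ha
  have hscale' : ∀ i (a : ℝ) (x : Fin (d + 2) → ℝ), a ≠ 0 →
      (a • x ∈ lowVar (d + 2) i ↔ x ∈ lowVar (d + 2) i) := fun i a x ha => smul_mem_lowVar ha
  -- As `t → -∞` the orbit of `w k l` becomes parallel to `b l`, so `w k l` is not in `highVar` at
  -- level `s l`; its zero first coordinate lowers the bound to `s l - 1`. As `t → +∞` the orbit
  -- becomes parallel to `b k`, which inherits this bound.
  have hs : ∀ k l, c l < c k → s k < s l := by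
    intro k l hc
    have hkl : k ≠ l := by rintro rfl; exact lt_irrefl _ hc
    have hz := hwne k l hkl
    have h1 : w k l ∉ highVar (d + 2) (s l) := by
      have h2 : ∀ᶠ t in atBot, linFlow (pathOp (d + 2)) t (w k l) ∉ highVar (d + 2) (s l) := by
        refine eventually_linFlow_notMem hb (hwl k l hkl) (fun m hm hm' => ?_)
          (isClosed_highVar _) (hscale _) ((hshigh l _).not.2 (lt_irrefl _))
        rcases hwm k l m hm' with rfl | rfl
        · exact tendsto_id.atBot_mul_const (by linarith)
        · exact absurd rfl hm
      obtain ⟨t, ht, ht0⟩ := (h2.and (eventually_lt_atBot 0)).exists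
      have h3 := linFlow_pathOp_notMem_highVar (linFlow_ne_zero (pathOp (d + 2)) t hz)
        (mem_lowVar_of_notMem_highVar ht) (neg_pos.2 ht0)
      rwa [(isFlow_linFlow _).neg_self] at h3
    obtain ⟨h2, h3⟩ := mem_lowVar_pred (hw0 k l) h1
    suffices s k ≤ s l - 1 by omega
    rw [← hslow]
    by_contra hcon
    have h4 : ∀ᶠ t in atTop, linFlow (pathOp (d + 2)) t (w k l) ∉ lowVar (d + 2) (s l - 1) := by
      refine eventually_linFlow_notMem hb (hwk k l hkl) (fun m hm hm' => ?_)
        (isClosed_lowVar _) (hscale' _) hcon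
      rcases hwm k l m hm' with rfl | rfl
      · exact absurd rfl hm
      · exact tendsto_id.atTop_mul_const_of_neg (by linarith)
    obtain ⟨t, ht, ht0⟩ := (h4.and (eventually_gt_atTop 0)).exists
    exact ht (mem_lowVar_of_notMem_highVar (linFlow_pathOp_notMem_highVar hz h3 ht0))
  have hsd : ∀ k, s k < d + 2 := fun k => by
    have := (hslow k (d + 1)).1 (hdim _)
    omega
  have hsinj : Function.Injective fun k => (⟨s k, hsd k⟩ : Fin (d + 2)) := by
    intro k l h
    have h' : s k = s l := congrArg Fin.val h
    refine hinj ?_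
    rcases lt_trichotomy (c k) (c l) with hc | hc | hc
    · have := hs l k hc; omega
    · exact hc
    · have := hs k l hc; omega
  let e : Fin (d + 2) ≃ Fin (d + 2) := Equiv.ofBijective _ (Finite.injective_iff_bijective.1 hsinj)
  have hse : ∀ m, s (e.symm m) = (m : ℕ) := fun m => congrArg Fin.val (e.apply_symm_apply m)
  refine ⟨b.reindex e, c ∘ e.symm, fun m m' hm => ?_, fun m => ?_, fun m i => ?_⟩
  · have hne : e.symm m ≠ e.symm m' := fun h => hm.ne (e.symm.injective h)
    by_contra! hle
    have h1 := hs _ _ (lt_of_le_of_ne hle (hinj.ne hne))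
    rw [hse, hse] at h1
    exact absurd hm (not_lt.2 (Fin.le_def.2 h1.le))
  · simp [hb]
  · simp only [Module.Basis.coe_reindex, Function.comp_apply, hslow, hshigh, hse]
    trivial

end Eigenbasis

/-! ### Products of spheres -/

section Product

lemma mem_unitSphere {m : ℕ} {x : EuclideanSpace ℝ (Fin m)} :
    x ∈ unitSphere m ↔ ∑ k, x k ^ 2 = 1 := by
  rw [unitSphere, EuclideanSpace.sphere_zero_eq 1 zero_le_one]
  simp

variable {E : Type*} [NormedAddCommGroup E] [NormedSpace ℝ E]

/-- Scaling by positive reals. -/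
noncomputable def expSmul (t : ℝ) (x : E) : E := Real.exp t • x

lemma isFlow_expSmul : IsFlow (expSmul : ℝ → E → E) := by
  refine ⟨fun x => by simp [expSmul], fun s t x => ?_, ?_⟩
  · rw [expSmul, expSmul, expSmul, smul_smul, Real.exp_add]
  · exact (Real.continuous_exp.comp continuous_fst).smul continuous_snd

/-- For `N` homogeneous of degree one, `-log N` is the logarithmic scaling time needed to reach the
level `N = 1`. -/
lemma neg_log_section {X : Set E} {N : E → ℝ} (hN : Continuous N)
    (hpos : ∀ x ∈ X, 0 < N x) (hsmul : ∀ t x, N (expSmul t x) = Real.exp t * N x) :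
    ContinuousOn (fun x => -Real.log (N x)) X ∧
      (∀ x ∈ X, ∀ t, -Real.log (N (expSmul t x)) = -Real.log (N x) - t) ∧
      ∀ x ∈ X, -Real.log (N x) = 0 ↔ N x = 1 := by
  refine ⟨(hN.continuousOn.log fun x hx => (hpos x hx).ne').neg, fun x hx t => ?_, fun x hx => ?_⟩
  · rw [hsmul, Real.log_mul (Real.exp_ne_zero _) (hpos x hx).ne', Real.log_exp]; ring
  · rw [neg_eq_zero, Real.log_eq_zero]
    have := hpos x hx
    constructor
    · rintro (h | h | h) <;> linarith
    · intro h; exact Or.inr (Or.inl h)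

variable [FiniteDimensional ℝ E] {m n : ℕ}

lemma continuous_repr {ι : Type*} [Finite ι] (b : Module.Basis ι ℝ E) (k : ι) :
    Continuous fun z => b.repr z k :=
  (b.coord k).continuous_of_finiteDimensional

/-- The sum of the squares of the coordinates of the first kind. -/
noncomputable def sqLeft (b : Module.Basis (Fin m ⊕ Fin n) ℝ E) (z : E) : ℝ :=
  ∑ k, b.repr z (Sum.inl k) ^ 2

/-- The sum of the squares of the coordinates of the second kind. -/
noncomputable def sqRight (b : Module.Basis (Fin m ⊕ Fin n) ℝ E) (z : E) : ℝ :=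
  ∑ k, b.repr z (Sum.inr k) ^ 2

lemma nonempty_homeomorph_sphere_prod (b : Module.Basis (Fin m ⊕ Fin n) ℝ E) :
    Nonempty ({z | sqLeft b z = 1 ∧ sqRight b z = 1} ≃ₜ unitSphere m × unitSphere n) := by
  have hc := continuous_repr b
  have hs : Continuous b.equivFun.symm :=
    b.equivFun.symm.toLinearMap.continuous_of_finiteDimensional
  have hr : ∀ f k, b.repr (b.equivFun.symm f) k = f k := fun f k => by
    rw [Module.Basis.equivFun_symm_apply, b.repr_sum_self]
  refine ⟨⟨⟨fun z => (⟨WithLp.toLp 2 fun k => b.repr z (Sum.inl k), mem_unitSphere.2 z.2.1⟩,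
      ⟨WithLp.toLp 2 fun k => b.repr z (Sum.inr k), mem_unitSphere.2 z.2.2⟩),
    fun p => ⟨b.equivFun.symm (Sum.elim p.1 p.2), ?_, ?_⟩, fun z => ?_, fun p => ?_⟩, ?_, ?_⟩⟩
  · rw [sqLeft]
    simp only [hr, Sum.elim_inl]
    exact mem_unitSphere.1 p.1.2
  · rw [sqRight]
    simp only [hr, Sum.elim_inr]
    exact mem_unitSphere.1 p.2.2
  · refine Subtype.ext (b.ext_elem fun k => ?_)
    rw [hr]
    cases k <;> rfl
  · refine Prod.ext (Subtype.ext ?_) (Subtype.ext ?_)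
    · ext k
      change b.repr (b.equivFun.symm _) (Sum.inl k) = _
      rw [hr]; rfl
    · ext k
      change b.repr (b.equivFun.symm _) (Sum.inr k) = _
      rw [hr]; rfl
  · refine Continuous.prodMk (Continuous.subtype_mk ?_ _) (Continuous.subtype_mk ?_ _)
    · exact (PiLp.continuous_toLp 2 _).comp
        (continuous_pi fun k => (hc _).comp continuous_subtype_val)
    · exact (PiLp.continuous_toLp 2 _).comp
        (continuous_pi fun k => (hc _).comp continuous_subtype_val)
  · refine Continuous.subtype_mk (hs.comp (continuous_pi fun k => ?_)) _
    cases k with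
    | inl k =>
      exact (continuous_apply k).comp ((PiLp.continuous_ofLp 2 _).comp
        (continuous_subtype_val.comp continuous_fst))
    | inr k =>
      exact (continuous_apply k).comp ((PiLp.continuous_ofLp 2 _).comp
        (continuous_subtype_val.comp continuous_snd))

/-- A hypersurface that is crossed once by the orbits of a linear flow with `m` fast and `n` slow
eigendirections is, up to scaling, a product of spheres. -/
theorem nonempty_homeomorph_of_hyperbolic [CompleteSpace E] {T : E →L[ℝ] E}
    {b : Module.Basis (Fin m ⊕ Fin n) ℝ E} {c : Fin m ⊕ Fin n → ℝ} (hinj : Function.Injective c)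
    (hc : ∀ k l, c (Sum.inr l) < c (Sum.inl k)) (hb : ∀ k, T (b k) = c k • b k)
    {C K : Set E} (hC : IsClosed C) (hK : IsClosed K) (hCK : C ∪ K = Set.univ)
    (hCs : ∀ (a : ℝ) (x : E), a ≠ 0 → (a • x ∈ C ↔ x ∈ C))
    (hKs : ∀ (a : ℝ) (x : E), a ≠ 0 → (a • x ∈ K ↔ x ∈ K))
    (hflow : ∀ x, x ≠ 0 → x ∈ C → ∀ t, 0 < t → linFlow T t x ∉ K)
    (hbK : ∀ k, b (Sum.inl k) ∉ K) (hbC : ∀ k, b (Sum.inr k) ∉ C)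
    {N : E → ℝ} (hN : Continuous N) (hpos : ∀ x, x ≠ 0 → 0 < N x) (hN0 : N 0 = 0)
    (hsmul : ∀ (t : ℝ) x, N (expSmul t x) = Real.exp t * N x) :
    Nonempty ({z | N z = 1 ∧ z ∈ C ∩ K} ≃ₜ unitSphere m × unitSphere n) := by
  classical
  have hφ := isFlow_linFlow T
  have hr := fun t z k => repr_linFlow (b := b) hb t z k
  have hmemC : ∀ y, y ∉ K → y ∈ C := fun y hy =>
    ((Set.ext_iff.1 hCK y).2 trivial).resolve_right hy
  have hmemK : ∀ y, y ∉ C → y ∈ K := fun y hy =>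
    ((Set.ext_iff.1 hCK y).2 trivial).resolve_left hy
  -- the dominant eigendirections
  have hsupp : ∀ z, z ≠ 0 → (Finset.univ.filter fun k => b.repr z k ≠ 0).Nonempty := by
    intro z hz
    by_contra hne
    rw [Finset.not_nonempty_iff_eq_empty, Finset.filter_eq_empty_iff] at hne
    exact hz (b.ext_elem fun k => by simpa using hne (Finset.mem_univ k))
  have htop : ∀ z, z ≠ 0 → ∃ k, b.repr z k ≠ 0 ∧ (∀ l, b.repr z l ≠ 0 → c l ≤ c k) ∧
      ∀ W : Set E, IsClosed W → (∀ (a : ℝ) (x : E), a ≠ 0 → (a • x ∈ W ↔ x ∈ W)) → b k ∉ W →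
        ∀ᶠ t in atTop, linFlow T t z ∉ W := by
    intro z hz
    obtain ⟨k, hk, hmax⟩ := Finset.exists_max_image _ c (hsupp z hz)
    have hk' : b.repr z k ≠ 0 := (Finset.mem_filter.1 hk).2
    have hmax' : ∀ l, b.repr z l ≠ 0 → c l ≤ c k := fun l hl => hmax l (by simpa using hl)
    refine ⟨k, hk', hmax', fun W hW hWs hbW =>
      eventually_linFlow_notMem hb hk' (fun l hl hl' => ?_) hW hWs hbW⟩
    have := lt_of_le_of_ne (hmax' l hl') (hinj.ne hl)
    exact tendsto_id.atTop_mul_const_of_neg (by linarith)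
  have hbot : ∀ z, z ≠ 0 → ∃ k, b.repr z k ≠ 0 ∧ (∀ l, b.repr z l ≠ 0 → c k ≤ c l) ∧
      ∀ W : Set E, IsClosed W → (∀ (a : ℝ) (x : E), a ≠ 0 → (a • x ∈ W ↔ x ∈ W)) → b k ∉ W →
        ∀ᶠ t in atBot, linFlow T t z ∉ W := by
    intro z hz
    obtain ⟨k, hk, hmin⟩ := Finset.exists_min_image _ c (hsupp z hz)
    have hk' : b.repr z k ≠ 0 := (Finset.mem_filter.1 hk).2
    have hmin' : ∀ l, b.repr z l ≠ 0 → c k ≤ c l := fun l hl => hmin l (by simpa using hl)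
    refine ⟨k, hk', hmin', fun W hW hWs hbW =>
      eventually_linFlow_notMem hb hk' (fun l hl hl' => ?_) hW hWs hbW⟩
    have := lt_of_le_of_ne (hmin' l hl') (hinj.ne hl.symm)
    exact tendsto_id.atBot_mul_const (by linarith)
  -- The vectors with both a fast and a slow component: their orbits become parallel to a slow
  -- eigenvector in the past and to a fast one in the future, hence must cross.
  let X : Set E := {z | (∃ k, b.repr z (Sum.inl k) ≠ 0) ∧ ∃ k, b.repr z (Sum.inr k) ≠ 0}
  have hX0 : ∀ z ∈ X, z ≠ 0 := by
    rintro z ⟨⟨k, hk⟩, -⟩ rfl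
    simp at hk
  have hX : ∀ t, ∀ z ∈ X, linFlow T t z ∈ X := by
    rintro t z ⟨⟨k, hk⟩, ⟨l, hl⟩⟩
    exact ⟨⟨k, by rw [hr]; exact mul_ne_zero (Real.exp_ne_zero _) hk⟩,
      ⟨l, by rw [hr]; exact mul_ne_zero (Real.exp_ne_zero _) hl⟩⟩
  have hXδ : ∀ t, ∀ z ∈ X, expSmul t z ∈ X := by
    rintro t z ⟨⟨k, hk⟩, ⟨l, hl⟩⟩
    exact ⟨⟨k, by simpa [expSmul] using hk⟩, ⟨l, by simpa [expSmul] using hl⟩⟩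
  have hexit : ∀ W : Set E, IsClosed W → (∀ (a : ℝ) (x : E), a ≠ 0 → (a • x ∈ W ↔ x ∈ W)) →
      ((∀ k, b (Sum.inl k) ∉ W) ∨ (∀ k, b (Sum.inr k) ∉ W)) → ∀ z ∈ X, ∃ t, linFlow T t z ∉ W := by
    rintro W hW hWs hbW z hz
    obtain ⟨⟨k, hk⟩, ⟨l, hl⟩⟩ := hz
    rcases hbW with hbW | hbW
    · obtain ⟨p, -, hp, h⟩ := htop z (hX0 z ⟨⟨k, hk⟩, ⟨l, hl⟩⟩)
      refine (h W hW hWs ?_).exists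
      rcases p with p | p
      · exact hbW p
      · exact absurd (hp _ hk) (not_le.2 (hc _ _))
    · obtain ⟨p, -, hp, h⟩ := hbot z (hX0 z ⟨⟨k, hk⟩, ⟨l, hl⟩⟩)
      refine (h W hW hWs ?_).exists
      rcases p with p | p
      · exact absurd (hp _ hl) (not_le.2 (hc _ _))
      · exact hbW p
  -- the given hypersurface
  obtain ⟨τ₀, hτ₀c, hτ₀f, hτ₀z⟩ := hφ.exists_crossing hX hC hK hCK
    (fun x hx hxC t ht => hflow x (hX0 x hx) hxC t ht) (hexit K hK hKs (Or.inl hbK))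
    (hexit C hC hCs (Or.inr hbC))
  -- Without fast components, the forward orbit would become parallel to a slow eigenvector and
  -- leave `C`, although it must stay in `C`. Without slow components, the backward orbit would
  -- leave `K` and could not return to it.
  have hCKX : ∀ z, z ≠ 0 → z ∈ C ∩ K → z ∈ X := by
    rintro z hz ⟨hzC, hzK⟩
    refine ⟨?_, ?_⟩
    · by_contra! hcon
      obtain ⟨p, hp, -, h⟩ := htop z hz
      have hpC : b p ∉ C := by
        rcases p with p | p
        · exact absurd (hcon p) hp
        · exact hbC p
      obtain ⟨t, ht, ht0⟩ := ((h C hC hCs hpC).and (eventually_gt_atTop 0)).exists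
      exact ht (hmemC _ (hflow z hz hzC t ht0))
    · by_contra! hcon
      obtain ⟨p, hp, -, h⟩ := hbot z hz
      have hpK : b p ∉ K := by
        rcases p with p | p
        · exact hbK p
        · exact absurd (hcon p) hp
      obtain ⟨t, ht, ht0⟩ := ((h K hK hKs hpK).and (eventually_lt_atBot 0)).exists
      have := hflow _ (linFlow_ne_zero T t hz) (hmemC _ ht) (-t) (neg_pos.2 ht0)
      rw [hφ.neg_self] at this
      exact this hzK
  -- the product of spheres
  have hL : Continuous (sqLeft b) := continuous_finsetSum _ fun k _ => (continuous_repr b _).pow 2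
  have hR : Continuous (sqRight b) := continuous_finsetSum _ fun k _ => (continuous_repr b _).pow 2
  have hLs : ∀ (a : ℝ) z, sqLeft b (a • z) = a ^ 2 * sqLeft b z := fun a z => by
    simp [sqLeft, mul_pow, Finset.mul_sum]
  have hRs : ∀ (a : ℝ) z, sqRight b (a • z) = a ^ 2 * sqRight b z := fun a z => by
    simp [sqRight, mul_pow, Finset.mul_sum]
  have hLpos : ∀ z ∈ X, 0 < sqLeft b z := by
    rintro z ⟨⟨k, hk⟩, -⟩
    exact Finset.sum_pos' (fun _ _ => sq_nonneg _) ⟨k, Finset.mem_univ _, by positivity⟩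
  have hRpos : ∀ z ∈ X, 0 < sqRight b z := by
    rintro z ⟨-, ⟨k, hk⟩⟩
    exact Finset.sum_pos' (fun _ _ => sq_nonneg _) ⟨k, Finset.mem_univ _, by positivity⟩
  have hbl : ∀ k, b (Sum.inl k) ∉ {z | sqLeft b z ≤ sqRight b z} := by
    intro k h
    have h1 : sqRight b (b (Sum.inl k)) = 0 := by simp [sqRight]
    have h2 : sqLeft b (b (Sum.inl k)) = 1 := by simp [sqLeft, Finsupp.single_apply]
    have h' : sqLeft b (b (Sum.inl k)) ≤ sqRight b (b (Sum.inl k)) := h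
    rw [h1, h2] at h'
    linarith
  have hbr : ∀ k, b (Sum.inr k) ∉ {z | sqRight b z ≤ sqLeft b z} := by
    intro k h
    have h1 : sqLeft b (b (Sum.inr k)) = 0 := by simp [sqLeft]
    have h2 : sqRight b (b (Sum.inr k)) = 1 := by simp [sqRight, Finsupp.single_apply]
    have h' : sqRight b (b (Sum.inr k)) ≤ sqLeft b (b (Sum.inr k)) := h
    rw [h1, h2] at h'
    linarith
  have hup : ∀ z ∈ X, z ∈ {z | sqRight b z ≤ sqLeft b z} → ∀ t, 0 < t →
      linFlow T t z ∉ {z | sqLeft b z ≤ sqRight b z} := by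
    intro z hz hle t ht h
    have hle' : sqRight b z ≤ sqLeft b z := hle
    have h' : sqLeft b (linFlow T t z) ≤ sqRight b (linFlow T t z) := h
    obtain ⟨⟨k₀, hk₀⟩, ⟨l₀, hl₀⟩⟩ := hz
    obtain ⟨k, -, hkmin⟩ := Finset.exists_min_image Finset.univ (fun k => c (Sum.inl k))
      ⟨k₀, Finset.mem_univ _⟩
    -- The growth factor of the slowest fast direction: `sqLeft` grows by at least `a ^ 2`, and
    -- `sqRight` by strictly less.
    set a := Real.exp (t * c (Sum.inl k)) with ha
    have h1 : a ^ 2 * sqLeft b z ≤ sqLeft b (linFlow T t z) := by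
      rw [sqLeft, sqLeft, Finset.mul_sum]
      refine Finset.sum_le_sum fun l _ => ?_
      rw [hr, mul_pow]
      have : a ≤ Real.exp (t * c (Sum.inl l)) :=
        Real.exp_le_exp.2 (mul_le_mul_of_nonneg_left (hkmin l (Finset.mem_univ _)) ht.le)
      gcongr
    have h2 : sqRight b (linFlow T t z) < a ^ 2 * sqRight b z := by
      rw [sqRight, sqRight, Finset.mul_sum]
      have hlt : ∀ l, Real.exp (t * c (Sum.inr l)) < a := fun l =>
        Real.exp_lt_exp.2 (mul_lt_mul_of_pos_left (hc _ _) ht)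
      refine Finset.sum_lt_sum (fun l _ => ?_) ⟨l₀, Finset.mem_univ _, ?_⟩
      · rw [hr, mul_pow]
        have := (hlt l).le
        gcongr
      · rw [hr, mul_pow]
        have := hlt l₀
        have h3 : 0 < b.repr z (Sum.inr l₀) ^ 2 := by positivity
        gcongr
    have h3 : a ^ 2 * sqRight b z ≤ a ^ 2 * sqLeft b z := by gcongr
    linarith
  obtain ⟨τ₁, hτ₁c, hτ₁f, hτ₁z⟩ := hφ.exists_crossing hX (isClosed_le hR hL) (isClosed_le hL hR)
    (Set.eq_univ_of_forall fun z => le_total (sqRight b z) (sqLeft b z)) hup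
    (hexit _ (isClosed_le hL hR) (fun a x ha => by
      have : 0 < a ^ 2 := by positivity
      simp only [Set.mem_ofPred_eq, hLs, hRs, mul_le_mul_iff_right₀ this]) (Or.inl hbl))
    (hexit _ (isClosed_le hR hL) (fun a x ha => by
      have : 0 < a ^ 2 := by positivity
      simp only [Set.mem_ofPred_eq, hLs, hRs, mul_le_mul_iff_right₀ this]) (Or.inr hbr))
  obtain ⟨hσ₀c, hσ₀f, hσ₀z⟩ := neg_log_section hN (fun x hx => hpos x (hX0 x hx)) hsmul
  -- The square root makes the quadratic form homogeneous of degree one.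
  obtain ⟨hσ₁c, hσ₁f, hσ₁z⟩ := neg_log_section (X := X) (N := fun z => √(sqLeft b z)) hL.sqrt
    (fun x hx => Real.sqrt_pos.2 (hLpos x hx)) (fun t x => by
      rw [expSmul, hLs, Real.sqrt_mul (sq_nonneg _), Real.sqrt_sq (Real.exp_pos t).le])
  have hδX : ∀ t, ∀ x ∈ X, expSmul t x ∈ C ∩ K ↔ x ∈ C ∩ K := fun t x _ => by
    rw [Set.mem_inter_iff, Set.mem_inter_iff, expSmul, hCs _ _ (Real.exp_ne_zero t),
      hKs _ _ (Real.exp_ne_zero t)]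
  have hτ₁z' : ∀ x ∈ X, τ₁ x = 0 ↔ sqLeft b x = sqRight b x := by
    intro x hx
    rw [← hτ₁z x hx]
    exact ⟨fun h => le_antisymm h.2 h.1, fun h => ⟨h.ge, h.le⟩⟩
  obtain ⟨e⟩ := hφ.nonempty_homeomorph_sections isFlow_expSmul hX hXδ (fun _ => 1)
    (fun t s x => by rw [expSmul, linFlow_smul, one_mul, expSmul])
    (τ := ![τ₀, τ₁]) (σ := ![fun z => -Real.log (N z), fun z => -Real.log √(sqLeft b z)])
    (by intro k; fin_cases k; exacts [hτ₀c, hτ₁c]) (by intro k; fin_cases k; exacts [hσ₀c, hσ₁c])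
    (by intro k; fin_cases k; exacts [hτ₀f, hτ₁f])
    (by
      intro k; fin_cases k
      · intro x hx t
        change τ₀ _ = 0 ↔ τ₀ _ = 0
        rw [← hτ₀z _ (hXδ t x hx), ← hτ₀z x hx, hδX t x hx]
      · intro x hx t
        change τ₁ _ = 0 ↔ τ₁ _ = 0
        rw [hτ₁z' _ (hXδ t x hx), hτ₁z' x hx, expSmul, hLs, hRs]
        exact mul_right_inj' (pow_ne_zero 2 (Real.exp_ne_zero t)))
    (by intro k; fin_cases k; exacts [hσ₀f, hσ₁f])
    (S := ![{z | N z = 1 ∧ z ∈ C ∩ K}, {z | sqLeft b z = 1 ∧ sqRight b z = 1}])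
    (by
      intro k x; fin_cases k
      · change (N x = 1 ∧ x ∈ C ∩ K) ↔ x ∈ X ∧ τ₀ x = 0 ∧ -Real.log (N x) = 0
        constructor
        · rintro ⟨h1, h2⟩
          have hx : x ∈ X := hCKX x (by rintro rfl; rw [hN0] at h1; exact zero_ne_one h1) h2
          exact ⟨hx, (hτ₀z x hx).1 h2, (hσ₀z x hx).2 h1⟩
        · rintro ⟨hx, h1, h2⟩
          exact ⟨(hσ₀z x hx).1 h2, (hτ₀z x hx).2 h1⟩
      · change (sqLeft b x = 1 ∧ sqRight b x = 1) ↔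
          x ∈ X ∧ τ₁ x = 0 ∧ -Real.log √(sqLeft b x) = 0
        constructor
        · rintro ⟨h1, h2⟩
          have hx : x ∈ X := by
            constructor
            · by_contra! hcon
              simp [sqLeft, hcon] at h1
            · by_contra! hcon
              simp [sqRight, hcon] at h2
          exact ⟨hx, (hτ₁z' x hx).2 (h1.trans h2.symm), (hσ₁z x hx).2 (by simp [h1])⟩
        · rintro ⟨hx, h1, h2⟩
          have h3 : √(sqLeft b x) = 1 := (hσ₁z x hx).1 h2
          rw [Real.sqrt_eq_one] at h3
          exact ⟨h3, by rw [← (hτ₁z' x hx).1 h1, h3]⟩)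
  obtain ⟨f⟩ := nonempty_homeomorph_sphere_prod b
  exact ⟨e.trans f⟩

/-- The vectors of `ℓ¹`-norm one whose sign variation is on the boundary between `i` and `i + 1`
form a product of spheres. -/
theorem nonempty_homeomorph_variation {d i : ℕ} (hi : i ≤ d) :
    Nonempty ({z : Fin (d + 2) → ℝ | ∑ j, |z j| = 1 ∧ z ∈ lowVar (d + 2) i ∩ highVar (d + 2) i} ≃ₜ
      unitSphere (i + 1) × unitSphere (d - i + 1)) := by
  obtain ⟨b, c, hc, hb, hbv⟩ := exists_eigenbasis d
  -- The eigenvectors with variation `0, …, i` avoid `highVar` and are the fast ones; the other `d -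
  -- i + 1` avoid `lowVar`.
  let e : Fin (i + 1) ⊕ Fin (d - i + 1) ≃ Fin (d + 2) :=
    finSumFinEquiv.trans (finCongr (by omega))
  have hl : ∀ k, (e (Sum.inl k) : ℕ) = k := fun k => by simp [e]
  have hr : ∀ k, (e (Sum.inr k) : ℕ) = i + 1 + k := fun k => by simp [e]
  refine nonempty_homeomorph_of_hyperbolic (T := pathOp (d + 2)) (b := b.reindex e.symm)
    (c := c ∘ e) (hc.injective.comp e.injective) (fun k l => hc ?_) (fun k => ?_)
    (isClosed_lowVar i) (isClosed_highVar i) (lowVar_union_highVar i)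
    (fun a x ha => smul_mem_lowVar ha) (fun a x ha => smul_mem_highVar ha)
    (fun x hx hl t ht => linFlow_pathOp_notMem_highVar hx hl ht) (fun k => ?_) (fun k => ?_)
    (continuous_finsetSum _ fun j _ => (continuous_apply j).abs) (fun x hx => ?_) (by simp)
    (fun t x => ?_)
  · rw [Fin.lt_def, hl, hr]; omega
  · simp [hb]
  · rw [Module.Basis.reindex_apply, Equiv.symm_symm, (hbv _ _).2, hl]; omega
  · rw [Module.Basis.reindex_apply, Equiv.symm_symm, (hbv _ _).1, hr]; omega
  · obtain ⟨j, hj⟩ := Function.ne_iff.1 hx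
    exact Finset.sum_pos' (fun _ _ => abs_nonneg _) ⟨j, Finset.mem_univ _, abs_pos.2 hj⟩
  · simp [expSmul, abs_mul, Finset.mul_sum]

end Product

/-! ### Spheres around a vector with prescribed support -/

section Local

variable {d : ℕ}

/-- The neighbour of `j` in the direction of `j₀`. -/
def towards (j₀ j : Fin (d + 1)) : Fin (d + 1) :=
  if (j₀ : ℕ) < j then ⟨j - 1, by omega⟩ else if h : (j : ℕ) < j₀ then ⟨j + 1, by omega⟩ else j

lemma towards_of_lt {j₀ j : Fin (d + 1)} (h : (j₀ : ℕ) < j) :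
    (towards j₀ j : ℕ) = j - 1 := by
  rw [towards, if_pos h]

lemma towards_of_gt {j₀ j : Fin (d + 1)} (h : (j : ℕ) < j₀) :
    (towards j₀ j : ℕ) = j + 1 := by
  rw [towards, if_neg (by omega), dif_pos h]

lemma exists_iterate_towards {J : Finset (Fin (d + 1))} {j₀ : Fin (d + 1)} (h₀ : j₀ ∈ J)
    (j : Fin (d + 1)) : ∃ n, (towards j₀)^[n] j ∈ J := by
  obtain ⟨m, hm⟩ : ∃ m, ((j : ℤ) - j₀).natAbs = m := ⟨_, rfl⟩
  induction m generalizing j with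
  | zero =>
    have : j = j₀ := Fin.ext (by omega)
    exact ⟨0, by simpa [this] using h₀⟩
  | succ m ih =>
    obtain ⟨n, hn⟩ := ih (towards j₀ j) (by
      rcases Nat.lt_or_ge (j₀ : ℕ) j with h | h
      · rw [towards_of_lt h]; omega
      · rw [towards_of_gt (by omega)]; omega)
    exact ⟨n + 1, hn⟩

/-- There is a grading that vanishes exactly on `J` and drops by one towards `j₀`. -/
lemma exists_depth {J : Finset (Fin (d + 1))} {j₀ : Fin (d + 1)} (h₀ : j₀ ∈ J) :
    ∃ w : Fin (d + 1) → ℕ, (∀ j ∈ J, w j = 0) ∧ ∀ j ∉ J, w j = w (towards j₀ j) + 1 := by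
  classical
  refine ⟨fun j => Nat.find (exists_iterate_towards h₀ j), fun j hj => ?_, fun j hj => ?_⟩
  · exact (Nat.find_eq_zero _).2 hj
  · exact Nat.find_comp_succ (exists_iterate_towards h₀ j)
      (exists_iterate_towards h₀ (towards j₀ j)) hj

/-- The operator that fixes the coordinates in `J` and pulls all others from the direction
of `j₀`. -/
noncomputable def pullOp (J : Finset (Fin (d + 1))) (j₀ : Fin (d + 1)) :
    (Fin (d + 1) → ℝ) →L[ℝ] (Fin (d + 1) → ℝ) :=
  ContinuousLinearMap.pi fun j =>
    if j ∈ J then 0 else ContinuousLinearMap.proj (towards j₀ j)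

variable {J : Finset (Fin (d + 1))} {j₀ : Fin (d + 1)}

lemma pullOp_of_mem {j : Fin (d + 1)} (h : j ∈ J) (z : Fin (d + 1) → ℝ) :
    pullOp J j₀ z j = 0 := by
  simp [pullOp, h]

lemma pullOp_of_notMem {j : Fin (d + 1)} (h : j ∉ J) (z : Fin (d + 1) → ℝ) :
    pullOp J j₀ z j = z (towards j₀ j) := by
  simp [pullOp, h]

/-- Outside `J` a coordinate is pulled from a neighbour of opposite parity; `j₀`, the only place
that is its own target, belongs to `J`. -/
lemma altMap_pullOp (h₀ : j₀ ∈ J) (z : Fin (d + 1) → ℝ) :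
    altMap (d + 1) (pullOp J j₀ z) = -pullOp J j₀ (altMap (d + 1) z) := by
  funext j
  rw [altMap_apply, Pi.neg_apply]
  by_cases hj : j ∈ J
  · simp [pullOp_of_mem hj]
  · rw [pullOp_of_notMem hj, pullOp_of_notMem hj, altMap_apply]
    have hne : (j : ℕ) ≠ j₀ := fun h => hj (Fin.ext h ▸ h₀)
    have hpar : ((towards j₀ j : ℕ) % 2 = 1) ↔ ¬ ((j : ℕ) % 2 = 1) := by
      rcases Nat.lt_or_ge (j₀ : ℕ) j with h | h
      · rw [towards_of_lt h]; omega
      · rw [towards_of_gt (by omega)]; omega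
    by_cases h : (j : ℕ) % 2 = 1
    · rw [if_pos h, if_neg (by rw [hpar]; simpa using h)]
    · rw [if_neg h, if_pos (hpar.2 h), neg_neg]

/-- At small times coordinate `j` takes the sign of the first nonzero coordinate met on the way from
`j` to `j₀`. This place depends monotonically on `j`, and since the walk has one direction there are
no ties. -/
lemma diminishes_pullOp (h₀ : j₀ ∈ J) {z : Fin (d + 1) → ℝ} (hz : ∀ j ∈ J, z j ≠ 0) :
    Diminishes (pullOp J j₀) z := by
  let R : Fin (d + 1) → Fin (d + 1) → Prop := fun j k => z k ≠ 0 ∧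
    ((j₀ ≤ k ∧ k ≤ j ∧ ∀ l, k < l → l ≤ j → z l = 0) ∨
      (k ≤ j₀ ∧ j ≤ k ∧ ∀ l, j ≤ l → l < k → z l = 0))
  have hex : ∀ (m : ℕ) (j : Fin (d + 1)), ((j : ℤ) - j₀).natAbs = m →
      ∃ k n, R j k ∧ (∀ m < n, (pullOp J j₀ ^ m) z j = 0) ∧ (pullOp J j₀ ^ n) z j = z k := by
    intro m
    induction m with
    | zero =>
      intro j hj
      have : j = j₀ := Fin.ext (by omega)
      subst this
      exact ⟨j, 0, ⟨hz j h₀, Or.inl ⟨le_rfl, le_rfl, fun l h1 h2 => absurd h1 (not_lt.2 h2)⟩⟩,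
        by simp, by simp⟩
    | succ m ih =>
      intro j hj
      by_cases hzj : z j = 0
      · have hjJ : j ∉ J := fun h => hz j h hzj
        have hs : ∀ m, (pullOp J j₀ ^ (m + 1)) z j = (pullOp J j₀ ^ m) z (towards j₀ j) :=
          fun m => by
            rw [pow_succ']
            exact pullOp_of_notMem hjJ _
        have hdist : ((towards j₀ j : ℕ) - j₀ : ℤ).natAbs = m := by
          rcases Nat.lt_or_ge (j₀ : ℕ) j with h | h
          · rw [towards_of_lt h]; omega
          · rw [towards_of_gt (by omega)]; omega
        obtain ⟨k, n, ⟨hk, hR⟩, h1, h2⟩ := ih _ hdist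
        refine ⟨k, n + 1, ⟨hk, ?_⟩, fun p hp => ?_, by rw [hs, h2]⟩
        · rcases Nat.lt_or_ge (j₀ : ℕ) j with h | h
          · have ht := towards_of_lt h
            simp only [Fin.le_def, Fin.lt_def] at hR ⊢
            refine Or.inl ⟨by omega, by omega, fun l hl1 hl2 => ?_⟩
            by_cases hlj : l = j
            · rw [hlj, hzj]
            · have hlj' : (l : ℕ) ≠ j := fun e => hlj (Fin.ext e)
              rcases hR with ⟨_, _, hR⟩ | ⟨_, _, _⟩
              · exact hR l hl1 (by omega)
              · omega
          · have ht := towards_of_gt (j₀ := j₀) (j := j) (by omega)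
            simp only [Fin.le_def, Fin.lt_def] at hR ⊢
            refine Or.inr ⟨by omega, by omega, fun l hl1 hl2 => ?_⟩
            by_cases hlj : l = j
            · rw [hlj, hzj]
            · have hlj' : (l : ℕ) ≠ j := fun e => hlj (Fin.ext e)
              rcases hR with ⟨_, _, _⟩ | ⟨_, _, hR⟩
              · omega
              · exact hR l (by omega) hl2
        · cases p with
          | zero => simpa using hzj
          | succ p => rw [hs]; exact h1 p (by omega)
      · refine ⟨j, 0, ⟨hzj, ?_⟩, by simp, by simp⟩
        rcases le_total j₀ j with h | h
        · exact Or.inl ⟨h, le_rfl, fun l h1 h2 => absurd h1 (not_lt.2 h2)⟩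
        · exact Or.inr ⟨h, le_rfl, fun l h1 h2 => absurd h1 (not_le.2 h2)⟩
  refine diminishes_of_rel R ?_ fun j => ?_
  · rintro j j' k k' hj ⟨hk, h1⟩ ⟨hk', h2⟩
    by_contra! hlt
    rcases h1 with ⟨a1, a2, a3⟩ | ⟨a1, a2, a3⟩ <;> rcases h2 with ⟨b1, b2, b3⟩ | ⟨b1, b2, b3⟩
    · exact hk (b3 k hlt (a2.trans hj.le))
    · exact absurd (hj.trans_le b2) (not_lt.2 (hlt.le.trans a2))
    · exact absurd hlt (not_lt.2 (a1.trans b1))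
    · exact hk' (a3 k' (hj.le.trans b2) hlt)
  · obtain ⟨k, n, hR, h1, h2⟩ := hex _ j rfl
    rcases hR.1.lt_or_gt with h | h
    · exact Or.inr (Or.inl ⟨k, n, hR, h, h1, by rwa [h2]⟩)
    · exact Or.inl ⟨k, n, hR, h, h1, by rwa [h2]⟩

lemma linFlow_pullOp_of_mem {j : Fin (d + 1)} (hj : j ∈ J) (t : ℝ) (z : Fin (d + 1) → ℝ) :
    linFlow (pullOp J j₀) t z j = z j := by
  have h := linFlow_semiconj (ContinuousLinearMap.proj j : (Fin (d + 1) → ℝ) →L[ℝ] ℝ)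
    (pullOp J j₀) 0 (fun z => by simp [pullOp_of_mem hj]) t z
  simpa [linFlow] using h

lemma linFlow_pullOp_of_towards_mem {j : Fin (d + 1)} (hj : j ∉ J) (hj' : towards j₀ j ∈ J) (t : ℝ)
    (z : Fin (d + 1) → ℝ) :
    linFlow (pullOp J j₀) t z j = z j + t * z (towards j₀ j) := by
  have hder : ∀ t, HasDerivAt (fun t => linFlow (pullOp J j₀) t z j - t * z (towards j₀ j)) 0 t := by
    intro t
    have h1 := hasDerivAt_pi.1 (hasDerivAt_linFlow (pullOp J j₀) z t) j
    have h2 : linFlow (pullOp J j₀) t (pullOp J j₀ z) j = z (towards j₀ j) := by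
      rw [← linFlow_semiconj (pullOp J j₀) (pullOp J j₀) (pullOp J j₀) (fun _ => rfl),
        pullOp_of_notMem hj, linFlow_pullOp_of_mem hj']
    rw [h2] at h1
    exact (h1.sub ((hasDerivAt_id t).mul_const (z (towards j₀ j)))).congr_deriv (by simp)
  have h := is_const_of_deriv_eq_zero (fun t => (hder t).differentiableAt)
    (fun t => (hder t).deriv) t 0
  simp only [(isFlow_linFlow (pullOp J j₀)).zero, zero_mul, sub_zero] at h
  linarith

/-- The dilation of weight `w`. -/
noncomputable def dilation (w : Fin d → ℕ) (t : ℝ) (z : Fin d → ℝ) : Fin d → ℝ :=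
  fun j => Real.exp (t * w j) * z j

lemma isFlow_dilation (w : Fin d → ℕ) : IsFlow (dilation w) := by
  refine ⟨fun x => by funext j; simp [dilation], fun s t x => ?_, ?_⟩
  · funext j
    simp only [dilation]
    rw [← mul_assoc, ← Real.exp_add, ← add_mul]
  · refine continuous_pi fun j => ?_
    exact (Real.continuous_exp.comp (continuous_fst.mul continuous_const)).mul
      ((continuous_apply j).comp continuous_snd)

/-- The weight drops by one along each pull, so the dilation conjugates the generator to a multiple
of itself. The two actions commute only up to a change of time, which the function `κ` of
`nonempty_homeomorph_sections` accommodates. -/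
lemma linFlow_pullOp_dilation {w : Fin (d + 1) → ℕ}
    (hw : ∀ j ∉ J, w j = w (towards j₀ j) + 1) (t s : ℝ) (z : Fin (d + 1) → ℝ) :
    linFlow (pullOp J j₀) t (dilation w s z) =
      dilation w s (linFlow (pullOp J j₀) (Real.exp (-s) * t) z) := by
  let D : (Fin (d + 1) → ℝ) →L[ℝ] (Fin (d + 1) → ℝ) :=
    ContinuousLinearMap.pi fun j => Real.exp (s * w j) • ContinuousLinearMap.proj j
  have hD : ∀ z, D z = dilation w s z := fun z => by
    funext j; simp [D, dilation]
  have h := linFlow_semiconj D (Real.exp (-s) • pullOp J j₀) (pullOp J j₀) (fun z => by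
    funext j
    rw [hD, hD]
    by_cases hj : j ∈ J
    · simp [dilation, pullOp_of_mem hj]
    · simp only [dilation, pullOp_of_notMem hj, smul_apply, Pi.smul_apply, smul_eq_mul, hw j hj]
      rw [← mul_assoc, ← Real.exp_add]
      congr 2
      push_cast
      ring) t z
  rw [hD, hD, linFlow_smul_generator] at h
  exact h.symm

/-- A continuous function that grows at least exponentially along a flow has transversal
level sets. -/
lemma IsFlow.exists_level {E : Type*} [TopologicalSpace E] {δ : ℝ → E → E} (h : IsFlow δ)
    {X : Set E} (hX : ∀ t, ∀ x ∈ X, δ t x ∈ X) {N : E → ℝ} (hN : Continuous N)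
    (hpos : ∀ x ∈ X, 0 < N x) (hgrow : ∀ t x, 0 ≤ t → Real.exp t * N x ≤ N (δ t x)) :
    ∃ σ : E → ℝ, ContinuousOn σ X ∧ (∀ x ∈ X, ∀ t, σ (δ t x) = σ x - t) ∧
      ∀ x ∈ X, σ x = 0 ↔ N x = 1 := by
  have htop : ∀ x ∈ X, ∃ t, 0 ≤ t ∧ 1 < Real.exp t * N x := by
    intro x hx
    obtain ⟨t, ht, ht0⟩ := (((Real.tendsto_exp_atTop.atTop_mul_const (hpos x hx)).eventually
      (eventually_gt_atTop 1)).and (eventually_ge_atTop 0)).exists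
    exact ⟨t, ht0, ht⟩
  have hbot : ∀ x ∈ X, ∃ t, 0 ≤ t ∧ N x < Real.exp t := by
    intro x hx
    obtain ⟨t, ht, ht0⟩ := ((Real.tendsto_exp_atTop.eventually
      (eventually_gt_atTop (N x))).and (eventually_ge_atTop 0)).exists
    exact ⟨t, ht0, ht⟩
  obtain ⟨σ, h1, h2, h3⟩ := h.exists_crossing hX (C := {x | 1 ≤ N x}) (K := {x | N x ≤ 1})
    (isClosed_le continuous_const hN) (isClosed_le hN continuous_const)
    (Set.eq_univ_of_forall fun x => le_total 1 (N x)) (fun x hx hle t ht hle' => by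
      have h1 : 1 ≤ N x := hle
      have h2 : N (δ t x) ≤ 1 := hle'
      have h3 := hgrow t x ht.le
      have h4 := Real.one_lt_exp_iff.2 ht
      nlinarith) (fun x hx => by
      obtain ⟨t, ht, h⟩ := htop x hx
      exact ⟨t, not_le.2 (h.trans_le (hgrow t x ht))⟩) (fun x hx => by
      obtain ⟨t, ht, hlt⟩ := hbot x hx
      refine ⟨-t, fun hle => ?_⟩
      have h1 : 1 ≤ N (δ (-t) x) := hle
      have h2 := hgrow t (δ (-t) x) ht
      rw [h.add, add_neg_cancel, h.zero] at h2
      have h3 := Real.exp_pos t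
      nlinarith)
  refine ⟨σ, h1, h2, fun x hx => ?_⟩
  rw [← h3 x hx]
  exact ⟨fun h => le_antisymm h.2 h.1, fun h => ⟨h.ge, h.le⟩⟩

lemma nonempty_homeomorph_coordinate_sphere {m : ℕ} {j₁ : Fin (d + 1)} (hj₁ : j₁ ∉ J)
    (hm : m + J.card = d) (s : Fin (d + 1) → ℝ) (hs : s j₁ = 0) :
    Nonempty ({z : Fin (d + 1) → ℝ | (∀ j ∈ J, z j = s j) ∧ z j₁ = 0 ∧ ∑ j ∈ Jᶜ, z j ^ 2 = 1} ≃ₜ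
      unitSphere m) := by
  classical
  have hcard : Fintype.card {j // j ∈ Jᶜ.erase j₁} = m := by
    rw [Fintype.card_coe, Finset.card_erase_of_mem (by simpa using hj₁), Finset.card_compl,
      Fintype.card_fin]
    omega
  let e := Fintype.equivFinOfCardEq hcard
  have hsum : ∀ z : Fin (d + 1) → ℝ, z j₁ = 0 →
      ∑ j ∈ Jᶜ, z j ^ 2 = ∑ k, z (e.symm k) ^ 2 := by
    intro z hz
    rw [e.symm.sum_comp (fun j => z j ^ 2), Finset.sum_coe_sort (Jᶜ.erase j₁) (fun j => z j ^ 2),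
      Finset.sum_erase _ (by simp [hz])]
  let g : EuclideanSpace ℝ (Fin m) → Fin (d + 1) → ℝ := fun x j =>
    if h : j ∈ Jᶜ.erase j₁ then x (e ⟨j, h⟩) else s j
  have hg1 : ∀ x, ∀ j ∈ J, g x j = s j := fun x j hj => dif_neg (by simp [hj])
  have hg2 : ∀ x, g x j₁ = 0 := fun x => by simp only [g]; rw [dif_neg (by simp), hs]
  have hg3 : ∀ x k, g x (e.symm k) = x k := fun x k => by
    simp only [g]; rw [dif_pos (e.symm k).2]; simp
  refine ⟨⟨⟨fun z => ⟨WithLp.toLp 2 fun k => z.1 (e.symm k), mem_unitSphere.2 ?_⟩,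
    fun x => ⟨g x, hg1 x, hg2 x, ?_⟩, fun z => Subtype.ext (funext fun j => ?_),
    fun x => Subtype.ext ?_⟩, ?_, ?_⟩⟩
  · exact (hsum _ z.2.2.1).symm.trans z.2.2.2
  · rw [hsum _ (hg2 x)]
    simp only [hg3]
    exact mem_unitSphere.1 x.2
  · by_cases h : j ∈ Jᶜ.erase j₁
    · have := hg3 (WithLp.toLp 2 fun k => z.1 (e.symm k)) (e ⟨j, h⟩)
      simpa using this
    · change g _ j = _
      simp only [g]
      rw [dif_neg h]
      by_cases hj : j = j₁
      · rw [hj, hs, z.2.2.1]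
      · refine (z.2.1 j ?_).symm
        by_contra hjJ
        exact h (by simp [hj, hjJ])
  · ext k
    exact hg3 x k
  · have hcont : ∀ j, Continuous fun z : {z : Fin (d + 1) → ℝ | (∀ j ∈ J, z j = s j) ∧
        z j₁ = 0 ∧ ∑ j ∈ Jᶜ, z j ^ 2 = 1} => z.1 j := fun j =>
      (continuous_apply j).comp continuous_subtype_val
    exact Continuous.subtype_mk ((PiLp.continuous_toLp 2 _).comp
      (continuous_pi fun k => hcont _)) _
  · refine Continuous.subtype_mk (continuous_pi fun j => ?_) _
    simp only [g]
    by_cases h : j ∈ Jᶜ.erase j₁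
    · simp only [dif_pos h]
      exact (continuous_apply _).comp ((PiLp.continuous_ofLp 2 _).comp continuous_subtype_val)
    · simp only [dif_neg h]
      exact continuous_const

/-- The set of directions at `s` along which the sign variation remains on the boundary between
`i` and `i + 1` is a sphere. -/
theorem nonempty_homeomorph_local {i m : ℕ} (hi : i < d) (h₀ : j₀ ∈ J) (hm : m + J.card = d)
    {s : Fin (d + 1) → ℝ} (hs : ∀ j, s j ≠ 0 ↔ j ∈ J)
    (hsM : s ∈ lowVar (d + 1) i ∩ highVar (d + 1) i) :
    Nonempty ({z : Fin (d + 1) → ℝ | (∀ j ∈ J, z j = s j) ∧ ∑ j ∈ Jᶜ, |z j| = 1 ∧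
      z ∈ lowVar (d + 1) i ∩ highVar (d + 1) i} ≃ₜ unitSphere m) := by
  classical
  obtain ⟨w, hw0, hw1⟩ := exists_depth h₀
  have hs0 : ∀ j ∉ J, s j = 0 := fun j hj => by
    by_contra h
    exact hj ((hs j).1 h)
  -- a coordinate next to `J`
  obtain ⟨j₁, hj₁, hj₁'⟩ : ∃ j, j ∉ J ∧ towards j₀ j ∈ J := by
    have hne : Jᶜ.Nonempty := by
      rw [← Finset.card_pos, Finset.card_compl, Fintype.card_fin]
      omega
    obtain ⟨j, hj, hmin⟩ := Finset.exists_min_image Jᶜ w hne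
    have hj' : j ∉ J := by simpa using hj
    refine ⟨j, hj', ?_⟩
    by_contra hcon
    have h1 := hmin (towards j₀ j) (by simpa using hcon)
    have h2 := hw1 j hj'
    omega
  have hsp : s (towards j₀ j₁) ≠ 0 := (hs _).2 hj₁'
  set T := pullOp J j₀ with hTdef
  have hφ := isFlow_linFlow T
  have hδ := isFlow_dilation w
  have hcomm := linFlow_pullOp_dilation hw1
  let A : Set (Fin (d + 1) → ℝ) := {z | ∀ j ∈ J, z j = s j}
  have hAφ : ∀ t, ∀ z ∈ A, linFlow T t z ∈ A := fun t z hz j hj => by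
    rw [hTdef, linFlow_pullOp_of_mem hj]; exact hz j hj
  have hAδ : ∀ t, ∀ z ∈ A, dilation w t z ∈ A := fun t z hz j hj => by
    simp [dilation, hw0 j hj, hz j hj]
  have hsA : s ∈ A := fun j _ => rfl
  have hcross : ∀ z ∈ A, z ∈ lowVar (d + 1) i → ∀ t, 0 < t →
      linFlow T t z ∉ highVar (d + 1) i := by
    intro z hz hl t ht
    refine linFlow_notMem_highVar (altMap_pullOp h₀) hAφ (fun z hz => diminishes_pullOp h₀ ?_)
      (fun z hz => diminishes_pullOp h₀ ?_) hi hz hl ht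
    · intro j hj
      rw [hz j hj]; exact (hs j).2 hj
    · intro j hj
      rw [altMap_apply, hz j hj]
      split_ifs
      · exact neg_ne_zero.2 ((hs j).2 hj)
      · exact (hs j).2 hj
  have hδs : ∀ t, dilation w t s = s := fun t => by
    funext j
    by_cases hj : j ∈ J
    · simp [dilation, hw0 j hj]
    · simp [dilation, hs0 j hj]
  have hδM : ∀ t z, dilation w t z ∈ lowVar (d + 1) i ∩ highVar (d + 1) i ↔
      z ∈ lowVar (d + 1) i ∩ highVar (d + 1) i := fun t z => by
    exact and_congr
      (mem_lowVar_congr (fun j => Real.exp (t * w j)) (fun j => Real.exp_pos _) (fun j => rfl))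
      (mem_highVar_congr (fun j => Real.exp (t * w j)) (fun j => Real.exp_pos _) (fun j => rfl))
  have hδlim : ∀ z ∈ A, Tendsto (fun t => dilation w (-t) z) atTop (𝓝 s) := by
    intro z hz
    refine tendsto_pi_nhds.2 fun j => ?_
    by_cases hj : j ∈ J
    · simp [dilation, hw0 j hj, hz j hj]
    · rw [hs0 j hj]
      have hwj : (0 : ℝ) < w j := by
        rw [hw1 j hj]; positivity
      have h1 : Tendsto (fun t : ℝ => -t * w j) atTop atBot :=
        tendsto_neg_atTop_atBot.atBot_mul_const hwj
      simpa [dilation] using (Real.tendsto_exp_atBot.comp h1).mul_const (z j)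
  -- Backward dilation moves any `z` in `A` close to `s`, so the contracted point leaves `W` at time
  -- `a` as `s` does. Conjugating by the dilation transfers this to `z`, at another time.
  have hfar : ∀ (W : Set (Fin (d + 1) → ℝ)) (a : ℝ), IsClosed W →
      (∀ t z, dilation w t z ∈ W ↔ z ∈ W) → linFlow T a s ∉ W →
      ∀ z ∈ A, ∃ t, linFlow T t z ∉ W := by
    intro W a hW hWδ ha z hz
    have h1 : Tendsto (fun t => linFlow T a (dilation w (-t) z)) atTop (𝓝 (linFlow T a s)) :=
      ((hφ.continuous_right a).tendsto s).comp (hδlim z hz)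
    obtain ⟨t, ht⟩ := (h1.eventually (hW.isOpen_compl.mem_nhds ha)).exists
    have h2 : linFlow T a (dilation w (-t) z) ∉ W := ht
    rw [hcomm, hWδ] at h2
    exact ⟨_, h2⟩
  -- The orbit of `s` is removed: `s` is fixed by the dilation, so it cannot be brought to a
  -- prescribed norm.
  let X : Set (Fin (d + 1) → ℝ) := {z | z ∈ A ∧ ∀ t, z ≠ linFlow T t s}
  have hX : ∀ t, ∀ z ∈ X, linFlow T t z ∈ X := by
    rintro t z ⟨hz, hne⟩
    refine ⟨hAφ t z hz, fun t' h => hne (-t + t') ?_⟩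
    rw [← hφ.add, ← h, hφ.neg_self]
  have hXδ : ∀ t, ∀ z ∈ X, dilation w t z ∈ X := by
    rintro t z ⟨hz, hne⟩
    refine ⟨hAδ t z hz, fun t' h => hne (Real.exp (-t) * t') ?_⟩
    rw [← hδs t, hcomm] at h
    rw [← hδ.neg_self t z, h, hδ.neg_self]
  obtain ⟨τ₀, hτ₀c, hτ₀f, hτ₀z⟩ := hφ.exists_crossing hX (isClosed_lowVar i) (isClosed_highVar i)
    (lowVar_union_highVar i) (fun x hx => hcross x hx.1)
    (fun x hx => hfar _ 1 (isClosed_highVar i) (fun t z => mem_highVar_congr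
      (fun j => Real.exp (t * w j)) (fun j => Real.exp_pos _) (fun j => rfl))
      (hcross s hsA hsM.1 1 one_pos) x hx.1)
    (fun x hx => hfar _ (-1) (isClosed_lowVar i) (fun t z => mem_lowVar_congr
      (fun j => Real.exp (t * w j)) (fun j => Real.exp_pos _) (fun j => rfl))
      (fun h => by
        have := hcross _ (hAφ (-1) s hsA) h 1 one_pos
        rw [hφ.add, add_neg_cancel, hφ.zero] at this
        exact this hsM.2) x hx.1)
  have hpull : ∀ t z, linFlow T t z j₁ = z j₁ + t * z (towards j₀ j₁) :=
    linFlow_pullOp_of_towards_mem hj₁ hj₁'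
  have hXs : ∀ z ∈ X, ∃ j ∈ Jᶜ, z j ≠ 0 := by
    rintro z ⟨hz, hne⟩
    by_contra! hcon
    refine hne 0 ?_
    rw [hφ.zero]
    funext j
    by_cases hj : j ∈ J
    · exact hz j hj
    · rw [hs0 j hj, hcon j (by simpa using hj)]
  have hexp : ∀ (t : ℝ) (j : Fin (d + 1)), 0 ≤ t → j ∈ Jᶜ → Real.exp t ≤ Real.exp (t * w j) := by
    intro t j ht hj
    have hj' : j ∉ J := by simpa using hj
    have h1 : (1 : ℝ) ≤ w j := by
      rw [hw1 j hj']; push_cast; linarith [(Nat.cast_nonneg (w (towards j₀ j)) : (0 : ℝ) ≤ _)]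
    exact Real.exp_le_exp.2 (by nlinarith)
  obtain ⟨σ₀, hσ₀c, hσ₀f, hσ₀z⟩ := hδ.exists_level hXδ (N := fun z => ∑ j ∈ Jᶜ, |z j|)
    (continuous_finsetSum _ fun j _ => (continuous_apply j).abs) (fun x hx => by
      obtain ⟨j, hj, hne⟩ := hXs x hx
      exact Finset.sum_pos' (fun _ _ => abs_nonneg _) ⟨j, hj, abs_pos.2 hne⟩) (fun t x ht => by
      rw [Finset.mul_sum]
      refine Finset.sum_le_sum fun j hj => ?_
      rw [dilation, abs_mul, Real.abs_exp]
      exact mul_le_mul_of_nonneg_right (hexp t j ht hj) (abs_nonneg _))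
  obtain ⟨σ₁, hσ₁c, hσ₁f, hσ₁z⟩ := hδ.exists_level hXδ (N := fun z => ∑ j ∈ Jᶜ, z j ^ 2)
    (continuous_finsetSum _ fun j _ => (continuous_apply j).pow 2) (fun x hx => by
      obtain ⟨j, hj, hne⟩ := hXs x hx
      exact Finset.sum_pos' (fun _ _ => sq_nonneg _) ⟨j, hj, by positivity⟩) (fun t x ht => by
      rw [Finset.mul_sum]
      refine Finset.sum_le_sum fun j hj => ?_
      rw [dilation, mul_pow]
      have h1 := hexp t j ht hj
      have h2 := Real.one_le_exp ht
      exact mul_le_mul_of_nonneg_right (by nlinarith) (sq_nonneg _))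
  -- The crossing time of the hyperplane `z j₁ = 0`, the model that replaces the variation boundary.
  let τ₁ : (Fin (d + 1) → ℝ) → ℝ := fun z => -(z j₁ / s (towards j₀ j₁))
  have hτ₁z : ∀ z, τ₁ z = 0 ↔ z j₁ = 0 := fun z => by simp [τ₁, hsp]
  obtain ⟨e⟩ := hφ.nonempty_homeomorph_sections hδ hX hXδ (fun t => Real.exp (-t)) hcomm
    (τ := ![τ₀, τ₁]) (σ := ![σ₀, σ₁])
    (by
      intro k; fin_cases k
      · exact hτ₀c
      · exact (((continuous_apply j₁).div_const _).neg).continuousOn)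
    (by intro k; fin_cases k; exacts [hσ₀c, hσ₁c])
    (by
      intro k; fin_cases k
      · exact hτ₀f
      · intro x hx t
        change -(_ / _) = -(_ / _) - t
        rw [hpull, hx.1 _ hj₁']
        field_simp
        ring)
    (by
      intro k; fin_cases k
      · intro x hx t
        change τ₀ _ = 0 ↔ τ₀ _ = 0
        rw [← hτ₀z _ (hXδ t x hx), ← hτ₀z x hx, hδM]
      · intro x hx t
        change τ₁ _ = 0 ↔ τ₁ _ = 0
        rw [hτ₁z, hτ₁z]
        simp [dilation])
    (by intro k; fin_cases k; exacts [hσ₀f, hσ₁f])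
    (S := ![{z | (∀ j ∈ J, z j = s j) ∧ ∑ j ∈ Jᶜ, |z j| = 1 ∧
        z ∈ lowVar (d + 1) i ∩ highVar (d + 1) i},
      {z | (∀ j ∈ J, z j = s j) ∧ z j₁ = 0 ∧ ∑ j ∈ Jᶜ, z j ^ 2 = 1}])
    (by
      intro k x; fin_cases k
      · change ((∀ j ∈ J, x j = s j) ∧ ∑ j ∈ Jᶜ, |x j| = 1 ∧
          x ∈ lowVar (d + 1) i ∩ highVar (d + 1) i) ↔ x ∈ X ∧ τ₀ x = 0 ∧ σ₀ x = 0
        constructor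
        · rintro ⟨h1, h2, h3⟩
          have hx : x ∈ X := by
            refine ⟨h1, ?_⟩
            rintro t rfl
            rcases lt_trichotomy t 0 with ht | rfl | ht
            · have h4 := hcross _ h1 h3.1 (-t) (neg_pos.2 ht)
              rw [hφ.neg_self] at h4
              exact h4 hsM.2
            · rw [hφ.zero, Finset.sum_eq_zero fun j hj => by
                rw [hs0 j (by simpa using hj), abs_zero]] at h2
              exact zero_ne_one h2
            · exact hcross s hsA hsM.1 t ht h3.2
          exact ⟨hx, (hτ₀z x hx).1 h3, (hσ₀z x hx).2 h2⟩
        · rintro ⟨hx, h1, h2⟩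
          exact ⟨hx.1, (hσ₀z x hx).1 h2, (hτ₀z x hx).2 h1⟩
      · change ((∀ j ∈ J, x j = s j) ∧ x j₁ = 0 ∧ ∑ j ∈ Jᶜ, x j ^ 2 = 1) ↔
          x ∈ X ∧ τ₁ x = 0 ∧ σ₁ x = 0
        rw [hτ₁z]
        constructor
        · rintro ⟨h1, h2, h3⟩
          have hx : x ∈ X := by
            refine ⟨h1, ?_⟩
            rintro t rfl
            rw [hpull, hs0 j₁ hj₁, zero_add] at h2
            obtain rfl : t = 0 := (mul_eq_zero.1 h2).resolve_right hsp
            rw [hφ.zero, Finset.sum_eq_zero fun j hj => by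
              rw [hs0 j (by simpa using hj)]; simp] at h3
            exact zero_ne_one h3
          exact ⟨hx, h2, (hσ₁z x hx).2 h3⟩
        · rintro ⟨hx, h1, h2⟩
          exact ⟨hx.1, h1, (hσ₁z x hx).1 h2⟩)
  obtain ⟨f⟩ := nonempty_homeomorph_coordinate_sphere hj₁ hm s (hs0 j₁ hj₁)
  exact ⟨e.trans f⟩

end Local

/-! ### Geometric realizations -/

section Realization

variable {d : ℕ}

open scoped Classical in
/-- The face of the cross polytope that carries the vector `z`. -/
noncomputable def signFace (z : Fin d → ℝ) : Finset (Fin d × Bool) :=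
  Finset.univ.filter fun p => if p.2 then 0 < z p.1 else z p.1 < 0

lemma mem_signFace_true {z : Fin d → ℝ} {j : Fin d} : (j, true) ∈ signFace z ↔ 0 < z j := by
  simp [signFace]

lemma mem_signFace_false {z : Fin d → ℝ} {j : Fin d} : (j, false) ∈ signFace z ↔ z j < 0 := by
  simp [signFace]

lemma signFace_subset_facet {z : Fin d → ℝ} {u : Fin d → Bool} :
    signFace z ⊆ facet u ↔ Compat u z := by
  constructor
  · intro h j
    refine ⟨fun hu => ?_, fun hu => ?_⟩
    · by_contra! hlt
      have := mem_facet.1 (h (mem_signFace_false.2 hlt))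
      simp [hu] at this
    · by_contra! hlt
      have := mem_facet.1 (h (mem_signFace_true.2 hlt))
      simp [hu] at this
  · rintro h ⟨j, b⟩ hp
    rw [mem_facet]
    cases b
    · by_contra hne
      exact not_lt.2 ((h j).1 (by simpa using hne)) (mem_signFace_false.1 hp)
    · by_contra hne
      exact not_lt.2 ((h j).2 (by simpa using hne)) (mem_signFace_true.1 hp)

lemma signFace_mem_boundaryB {i : ℕ} {z : Fin (d + 1) → ℝ} :
    signFace z ∈ (boundaryB i (d + 1)).faces ↔
      (signFace z).Nonempty ∧ z ∈ lowVar (d + 1) i ∩ highVar (d + 1) i := by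
  rw [mem_boundaryB]
  simp only [signFace_subset_facet, lowVar, highVar, Set.mem_inter_iff, Set.mem_ofPred_eq,
    and_comm (b := Compat _ _)]

lemma signFace_nonempty {z : Fin d → ℝ} : (signFace z).Nonempty ↔ z ≠ 0 := by
  constructor
  · rintro ⟨⟨j, b⟩, hp⟩ rfl
    cases b
    · simpa using mem_signFace_false.1 hp
    · simpa using mem_signFace_true.1 hp
  · intro h
    obtain ⟨j, hj⟩ := Function.ne_iff.1 h
    rcases (show z j ≠ 0 from hj).lt_or_gt with h | h
    · exact ⟨_, mem_signFace_false.2 h⟩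
    · exact ⟨_, mem_signFace_true.2 h⟩

/-- The realization of a subcomplex of the cross polytope, as a subset of the `ℓ¹` sphere. -/
lemma nonempty_homeomorph_realization {K : PreAbstractSimplicialComplex (Fin d × Bool)}
    (hK : ∀ σ ∈ K.faces, ∃ u, σ ⊆ facet u) :
    Nonempty (realization K ≃ₜ {z : Fin d → ℝ | ∑ j, |z j| = 1 ∧ signFace z ∈ K.faces}) := by
  have hsum : ∀ x : Fin d × Bool → ℝ, ∑ p, x p = ∑ j, (x (j, true) + x (j, false)) := fun x => by
    rw [Fintype.sum_prod_type]
    simp only [Fintype.sum_bool]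
  have hzero : ∀ x ∈ realization K, ∀ j, x (j, true) = 0 ∨ x (j, false) = 0 := by
    rintro x ⟨-, -, σ, hσ, hx⟩ j
    obtain ⟨u, hu⟩ := hK σ hσ
    by_contra! h
    have h1 := mem_facet.1 (hu ((hx _).2 h.1))
    have h2 := mem_facet.1 (hu ((hx _).2 h.2))
    simp only [] at h1 h2
    rw [h1] at h2
    exact Bool.noConfusion h2
  let f : (Fin d × Bool → ℝ) → Fin d → ℝ := fun x j => x (j, true) - x (j, false)
  let g : (Fin d → ℝ) → Fin d × Bool → ℝ := fun z p => max (if p.2 then z p.1 else -z p.1) 0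
  have hf : ∀ x ∈ realization K, f x ∈
      {z : Fin d → ℝ | ∑ j, |z j| = 1 ∧ signFace z ∈ K.faces} := by
    intro x hx
    have h0 := hzero x hx
    obtain ⟨hnn, h1, σ, hσ, hxσ⟩ := hx
    constructor
    · rw [← h1, hsum]
      refine Finset.sum_congr rfl fun j _ => ?_
      simp only [f]
      have a := hnn (j, true)
      have b := hnn (j, false)
      rcases h0 j with h | h
      · rw [h, zero_sub, abs_neg, abs_of_nonneg b, zero_add]
      · rw [h, sub_zero, abs_of_nonneg a, add_zero]
    · suffices signFace (f x) = σ by rwa [this]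
      ext ⟨j, b⟩
      have a := hnn (j, true)
      have a' := hnn (j, false)
      cases b
      · rw [mem_signFace_false, hxσ]
        simp only [f]
        rcases h0 j with h | h
        · rw [h, zero_sub, neg_lt_zero]
          exact ⟨fun h => h.ne', fun h => lt_of_le_of_ne a' h.symm⟩
        · rw [h]; simpa using a
      · rw [mem_signFace_true, hxσ]
        simp only [f]
        rcases h0 j with h | h
        · rw [h]; simpa using a'
        · rw [h, sub_zero]
          exact ⟨fun h => h.ne', fun h => lt_of_le_of_ne a h.symm⟩
  have hg : ∀ z ∈ {z : Fin d → ℝ | ∑ j, |z j| = 1 ∧ signFace z ∈ K.faces}, g z ∈ realization K := by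
    rintro z ⟨h1, h2⟩
    refine ⟨fun p => le_max_right _ _, ?_, signFace z, h2, ?_⟩
    · rw [← h1, hsum]
      refine Finset.sum_congr rfl fun j _ => ?_
      simp [g]
    · rintro ⟨j, b⟩
      cases b
      · rw [mem_signFace_false]
        simp [g]
      · rw [mem_signFace_true]
        simp [g]
  refine ⟨⟨⟨fun x => ⟨f x, hf x x.2⟩, fun z => ⟨g z, hg z z.2⟩, fun x => Subtype.ext ?_,
    fun z => Subtype.ext ?_⟩, ?_, ?_⟩⟩
  · funext ⟨j, b⟩
    have a := x.2.1 (j, true)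
    have a' := x.2.1 (j, false)
    cases b <;> rcases hzero x x.2 j with h | h <;> simp [f, g, h, a, a']
  · funext j
    change max (if true then z.1 j else -z.1 j) 0 - max (if false then z.1 j else -z.1 j) 0 = z.1 j
    simp
  · exact Continuous.subtype_mk (continuous_pi fun j =>
      ((continuous_apply (j, true)).comp continuous_subtype_val).sub
        ((continuous_apply (j, false)).comp continuous_subtype_val)) _
  · refine Continuous.subtype_mk (continuous_pi fun p => ?_) _
    have h := (continuous_apply p.1).comp (continuous_subtype_val
      (p := fun z : Fin d → ℝ => ∑ j, |z j| = 1 ∧ signFace z ∈ K.faces))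
    simp only [g]
    split_ifs
    · exact h.max continuous_const
    · exact h.neg.max continuous_const

lemma ne_zero_of_sum_abs {z : Fin d → ℝ} (h : ∑ j, |z j| = 1) : z ≠ 0 := by
  rintro rfl
  simp at h

theorem nonempty_homeomorph_realization_boundaryB {d i : ℕ} (hi : i ≤ d) :
    Nonempty (realization (boundaryB i (d + 2)) ≃ₜ
      (unitSphere (i + 1) × unitSphere (d - i + 1))) := by
  obtain ⟨e⟩ := nonempty_homeomorph_realization (K := boundaryB i (d + 2)) fun σ hσ => by
    obtain ⟨-, ⟨u, -, hu⟩, -⟩ := (mem_boundaryB i (d + 1) σ).1 hσ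
    exact ⟨u, hu⟩
  obtain ⟨f⟩ := nonempty_homeomorph_variation hi
  refine ⟨(e.trans (Homeomorph.setCongr ?_)).trans f⟩
  ext z
  simp only [Set.mem_ofPred_eq]
  refine and_congr_right fun h => ?_
  rw [signFace_mem_boundaryB, signFace_nonempty]
  exact and_iff_right (ne_zero_of_sum_abs h)

open scoped Classical in
/-- The sign vector of a set of vertices of the cross polytope. -/
noncomputable def signVector (σ : Finset (Fin d × Bool)) : Fin d → ℝ := fun j =>
  if (j, true) ∈ σ then 1 else if (j, false) ∈ σ then -1 else 0

lemma signFace_add_signVector {σ : Finset (Fin d × Bool)} {u : Fin d → Bool} (hσ : σ ⊆ facet u)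
    {z : Fin d → ℝ} (hz : ∀ j ∈ σ.image Prod.fst, z j = 0) :
    signFace (z + signVector σ) = signFace z ∪ σ := by
  have hex : ∀ j, (j, true) ∈ σ → (j, false) ∉ σ := fun j h1 h2 => by
    have h3 := mem_facet.1 (hσ h1)
    have h4 := mem_facet.1 (hσ h2)
    simp only [] at h3 h4
    rw [h3] at h4
    exact Bool.noConfusion h4
  have hz' : ∀ j b, (j, b) ∈ σ → z j = 0 := fun j b h =>
    hz j (Finset.mem_image.2 ⟨_, h, rfl⟩)
  ext ⟨j, b⟩
  rw [Finset.mem_union]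
  cases b
  · rw [mem_signFace_false, mem_signFace_false, Pi.add_apply, signVector]
    by_cases h1 : (j, true) ∈ σ
    · simp [h1, hex j h1, hz' j _ h1]
    · by_cases h2 : (j, false) ∈ σ
      · simp [h1, h2, hz' j _ h2]
      · simp [h1, h2]
  · rw [mem_signFace_true, mem_signFace_true, Pi.add_apply, signVector]
    by_cases h1 : (j, true) ∈ σ
    · simp [h1, hz' j _ h1]
    · by_cases h2 : (j, false) ∈ σ
      · simp [h1, h2, hz' j _ h2]
      · simp [h1, h2]

lemma signVector_ne_zero_iff {σ : Finset (Fin d × Bool)} {j : Fin d} :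
    signVector σ j ≠ 0 ↔ j ∈ σ.image Prod.fst := by
  rw [signVector]
  constructor
  · intro h
    by_contra hcon
    have h1 : ∀ b, (j, b) ∉ σ := fun b hb => hcon (Finset.mem_image.2 ⟨_, hb, rfl⟩)
    simp [h1] at h
  · intro h
    obtain ⟨⟨k, b⟩, hp, rfl⟩ := Finset.mem_image.1 h
    cases b
    · split_ifs <;> simp_all
    · simp [hp]

/-- Translation by the sign vector `s` of `σ` turns a point of the link into a vector that agrees
with `s` on the support `J`, has `ℓ¹` norm one off `J`, and lies on the variation boundary. These
vectors form a sphere by `nonempty_homeomorph_local`. -/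
theorem isCombinatorialManifold_boundaryB {d i : ℕ} (hi : i < d + 1) :
    IsCombinatorialManifold d (boundaryB i (d + 2)) := by
  refine ⟨⟨_, singleton_mem_boundaryB hi (0, true)⟩, fun σ hσ => ?_⟩
  obtain ⟨⟨p₀, hp₀⟩, ⟨u, hu, hσu⟩, ⟨v, hv, hσv⟩⟩ := (mem_boundaryB i (d + 1) σ).1 hσ
  set J := σ.image Prod.fst with hJ
  set s := signVector σ with hs
  have hcardJ : J.card = σ.card := by
    refine Finset.card_image_of_injOn fun p hp q hq hpq => Prod.ext hpq ?_
    rw [← mem_facet.1 (hσu hp), ← mem_facet.1 (hσu hq), hpq]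
  -- A full facet would determine its word, which cannot have both at most and more than `i`
  -- switches.
  have hcard : σ.card ≤ d + 1 := by
    by_contra! hlt
    have h1 : σ = facet u := Finset.eq_of_subset_of_card_le hσu (by rw [card_facet]; omega)
    have h2 : σ = facet v := Finset.eq_of_subset_of_card_le hσv (by rw [card_facet]; omega)
    rw [facet_injective (h1.symm.trans h2)] at hu
    omega
  have hface : ∀ z : Fin (d + 2) → ℝ, (∀ j ∈ J, z j = 0) → signFace (z + s) = signFace z ∪ σ :=
    fun z hz => signFace_add_signVector hσu hz
  have hs0 : signFace s = σ := by
    have h0 : signFace (0 : Fin (d + 2) → ℝ) = ∅ := by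
      rw [← Finset.not_nonempty_iff_eq_empty, signFace_nonempty, not_not]
    have := hface 0 (fun _ _ => rfl)
    rwa [zero_add, h0, Finset.empty_union] at this
  have hsM : s ∈ lowVar (d + 2) i ∩ highVar (d + 2) i :=
    (signFace_mem_boundaryB.1 (hs0.symm ▸ hσ)).2
  refine ⟨d + 1 - σ.card, by omega, ?_⟩
  obtain ⟨e⟩ := nonempty_homeomorph_realization (K := link (boundaryB i (d + 2)) σ) fun τ hτ => by
    obtain ⟨-, -, hτ⟩ := hτ
    obtain ⟨-, ⟨u, -, hu⟩, -⟩ := (mem_boundaryB i (d + 1) _).1 hτ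
    exact ⟨u, Finset.subset_union_left.trans hu⟩
  obtain ⟨f⟩ := nonempty_homeomorph_local (d := d + 1) (m := d + 1 - σ.card) (s := s) (J := J)
    (j₀ := p₀.1) hi (Finset.mem_image_of_mem _ hp₀) (by omega)
    (fun j => signVector_ne_zero_iff) hsM
  refine ⟨(e.trans ((Homeomorph.addRight s).subtype fun z => ?_)).trans f⟩
  have key : (∀ j ∈ J, z j = 0) → ((∑ j, |z j| = 1 ∧
      signFace z ∈ (link (boundaryB i (d + 2)) σ).faces) ↔
      (∑ j ∈ Jᶜ, |(z + s) j| = 1 ∧ z + s ∈ lowVar (d + 2) i ∩ highVar (d + 2) i)) := by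
    intro hz
    have h1 : ∑ j ∈ Jᶜ, |(z + s) j| = ∑ j, |z j| := by
      rw [← Finset.sum_compl_add_sum J, Finset.sum_eq_zero (s := J)
        fun j hj => by rw [hz j hj, abs_zero], add_zero]
      refine Finset.sum_congr rfl fun j hj => ?_
      have : s j = 0 := by
        by_contra h
        exact Finset.mem_compl.1 hj (signVector_ne_zero_iff.1 h)
      rw [Pi.add_apply, this, add_zero]
    have h2 : Disjoint (signFace z) σ := by
      rw [Finset.disjoint_left]
      rintro ⟨j, b⟩ hp hq
      have : z j = 0 := hz j (Finset.mem_image.2 ⟨_, hq, rfl⟩)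
      cases b
      · exact (mem_signFace_false.1 hp).ne this
      · exact (mem_signFace_true.1 hp).ne' this
    rw [h1]
    refine and_congr_right fun h => ?_
    have h3 : signFace z ∪ σ = signFace (z + s) := (hface z hz).symm
    have h4 : (signFace (z + s)).Nonempty := by
      rw [← h3]; exact ⟨p₀, Finset.mem_union_right _ hp₀⟩
    constructor
    · rintro ⟨-, -, hmem⟩
      rw [h3, signFace_mem_boundaryB] at hmem
      exact hmem.2
    · intro hmem
      refine ⟨signFace_nonempty.2 (ne_zero_of_sum_abs h), h2, ?_⟩
      rw [h3, signFace_mem_boundaryB]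
      exact ⟨h4, hmem⟩
  constructor
  · intro h
    -- A nonzero coordinate over `J` would give a vertex of `σ` itself, against disjointness, or its
    -- antipode, which shares no face with it.
    have hz : ∀ j ∈ J, z j = 0 := by
      intro j hj
      obtain ⟨-, -, hdis, hmem⟩ := h
      obtain ⟨⟨k, b⟩, hp, rfl⟩ := Finset.mem_image.1 hj
      obtain ⟨-, ⟨w, -, hw⟩, -⟩ := (mem_boundaryB i (d + 1) _).1 hmem
      have hb := mem_facet.1 (hw (Finset.mem_union_right _ hp))
      simp only [] at hb
      by_contra hne
      rcases lt_or_gt_of_ne hne with hlt | hlt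
      · have hq := mem_signFace_false.2 hlt
        have hb' := mem_facet.1 (hw (Finset.mem_union_left _ hq))
        simp only [] at hb'
        obtain rfl : b = false := hb.symm.trans hb'
        exact Finset.disjoint_left.1 hdis hq hp
      · have hq := mem_signFace_true.2 hlt
        have hb' := mem_facet.1 (hw (Finset.mem_union_left _ hq))
        simp only [] at hb'
        obtain rfl : b = true := hb.symm.trans hb'
        exact Finset.disjoint_left.1 hdis hq hp
    refine ⟨fun j hj => ?_, (key hz).1 h⟩
    change z j + s j = s j
    rw [hz j hj, zero_add]
  · rintro ⟨h1, h2⟩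
    refine (key fun j hj => ?_).2 h2
    have h3 : z j + s j = s j := h1 j hj
    linarith

end Realization

end SparlaCS

theorem mainTheorem6 (r i : ℕ) (hi : i ≤ 2 * r) :
    SparlaCS.IsCombinatorialManifold (2 * r) (SparlaCS.boundaryB i (2 * r + 2)) ∧
    SparlaCS.IsCentrallySymmetric (SparlaCS.antipode (2 * r + 2))
      (SparlaCS.boundaryB i (2 * r + 2)) ∧
    (SparlaCS.vertices (SparlaCS.boundaryB i (2 * r + 2))).ncard = 4 * r + 4 ∧
    Nonempty (SparlaCS.realization (SparlaCS.boundaryB i (2 * r + 2)) ≃ₜ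
      (SparlaCS.unitSphere (i + 1) × SparlaCS.unitSphere (2 * r - i + 1))) ∧
    SparlaCS.eulerChar (SparlaCS.boundaryB i (2 * r + 2)) - 2 = 2 * (-1) ^ i ∧
    (i < r → i % 2 = r % 2 →
      SparlaCS.SparlaEquality r (2 * r + 2) (SparlaCS.boundaryB i (2 * r + 2)) ∧
      ¬ SparlaCS.skeleton r (SparlaCS.crossPolytope (SparlaCS.antipode (2 * r + 2))) ≤
        SparlaCS.boundaryB i (2 * r + 2) ∧
      ¬ SparlaCS.SparlaEqualityAssertion r (2 * r + 2)) := by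
  have hi' : i < 2 * r + 1 := by omega
  have hman := SparlaCS.isCombinatorialManifold_boundaryB hi'
  have hcs := SparlaCS.isCentrallySymmetric_boundaryB i (2 * r + 1)
  have heuler : SparlaCS.eulerChar (SparlaCS.boundaryB i (2 * r + 2)) - 2 = 2 * (-1) ^ i := by
    rw [SparlaCS.eulerChar_boundaryB hi', Nat.add_sub_cancel]
    have h1 : (-1 : ℤ) ^ (2 * r - i) = (-1) ^ i := by
      have h2 : (-1 : ℤ) ^ (2 * r - i) * (-1) ^ i = 1 := by
        rw [← pow_add, Nat.sub_add_cancel hi, pow_mul]; simp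
      have h3 : (-1 : ℤ) ^ i * (-1) ^ i = 1 := by rw [← mul_pow]; simp
      linear_combination (-1 : ℤ) ^ i * h2 - (-1) ^ (2 * r - i) * h3
    rw [h1, pow_succ, pow_mul]
    ring
  refine ⟨hman, hcs, ?_, SparlaCS.nonempty_homeomorph_realization_boundaryB hi, heuler,
    fun hir hpar => ?_⟩
  · rw [SparlaCS.ncard_vertices_boundaryB hi']; ring
  · have heq := SparlaCS.sparlaEquality_of_eulerChar hpar heuler
    refine ⟨heq, SparlaCS.not_skeleton_le_boundaryB hir, fun hS => ?_⟩
    -- All singletons are faces, so the complex uses the whole vertex set, as the assertion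
    -- requires.
    have h := hS (Fin (2 * r + 2) × Bool)
      ⟨SparlaCS.boundaryB i (2 * r + 2), fun p => SparlaCS.singleton_mem_boundaryB hi' p⟩
      (SparlaCS.antipode (2 * r + 2)) (by simp [mul_comm]) hcs hman
    exact SparlaCS.not_skeleton_le_boundaryB hir (h.1 heq)
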